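/- Let $n\ge 3$ be an integer and let $a<n$, $b<n$ be real numbers. Let $\mathbf X=((x_{1k},x_{2k}))_{k=1}^n$ be an independent sample from the bivariate normal distribution with means $\mu_1,\mu_2\in\mathbb R$, standard deviations $\sigma_1,\sigma_2>0$ and correlation $\rho\in(-1,1)$. Put $\bar x_i=n^{-1}\sum_k x_{ik}$, $s_{ij}=\sum_{k}(x_{ik}-\bar x_i)(x_{jk}-\bar x_j)$, $r=s_{12}/\sqrt{s_{11}s_{22}}$, and $$\theta_4=\frac{\sigma_2\sqrt{1-\rho^2}}{\sigma_1}.$$ Consider the posterior distribution of $(\mu_1,\mu_2,\sigma_1,\sigma_2,\rho)$ given $\mathbf X$ under the (improper) prior density $$\pi_{ab}(\mu_1,\mu_2,\sigma_1,\sigma_2,\rho)=\frac{1}{\sigma_1^{3-a}\,\sigma_2^{2-b}\,(1-\rho^2)^{2-b/2}}$$ with respect to $d\mu_1\,d\mu_2\,d\sigma_1\,d\sigma_2\,d\rho$ on $\mathbb R^2\times(0,\infty)^2\times(-1,1)$. For $\nu_1,\nu_2>0$ write $\chi^2_{\nu_1},\chi^2_{\nu_2}$ (with or without a star) for independent chi-squared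 random variables with these degrees of freedom, and $(Y)_{q}$ for the $q$-quantile of a random variable $Y$. (a) For every data set $\mathbf X$ with $s_{11}>0$, $s_{22}>0$ and $|r|<1$, the posterior is a proper probability distribution, and the posterior distribution of $\theta_4$ given $\mathbf X$ is the distribution (with $\mathbf X$ held fixed) of $$\theta_4^*=\sqrt{\frac{\chi^{2*}_{n-a}}{\chi^{2*}_{n-b}}}\;\sqrt{\frac{s_{22}(1-r^2)}{s_{11}}}.$$ In particular, for $\alpha\in(0,1)$, the interval $(0,(\theta_4^*)_{1-\alpha})$ has posterior probability $1-\alpha$ for $\theta_4$. (b) For all $\mu_1,\mu_2\in\mathbb R$, $\sigma_1,\sigma_2>0$, $\rho\in(-1,1)$ and $\alpha\in(0,1)$, the frequentist coverage of this one-sided credible interval is $$P\big(\theta_4<(\theta_4^*)_{1-\alpha}\,\big|\,\mu_1,\mu_2,\sigma_1,\sigma_2,\rho\big)=P\left(\frac{\chi^2_{n-1}}{\chi^2_{n-2}}<\left(\frac{\chi^{2*}_{n-a}}{\chi^{2*}_{n-b}}\right)_{1-\alpha}\right),$$ where on the left $\mathbf X$ is random and the parameters are fixed; in particular it does not depend on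 $\rho$, nor on the other parameters. Furthermore, for every fixed $(\mu_1,\mu_2,\sigma_1,\sigma_2,\rho)$, this coverage equals $1-\alpha$ for every $\alpha\in(0,1)$ if and only if $(a,b)=(1,2)$. -/

import Mathlib

open MeasureTheory ProbabilityTheory Set

noncomputable section

namespace BivariateNormal

/-! ### The bivariate normal model -/

/-- Density at `x` of the bivariate normal law with means `μ₁, μ₂`, standard deviations `σ₁, σ₂`
and correlation `ρ`. -/
def normalPDF (μ₁ μ₂ σ₁ σ₂ ρ : ℝ) (x : ℝ × ℝ) : ℝ :=
  (2 * Real.pi * σ₁ * σ₂ * √(1 - ρ ^ 2))⁻¹ *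
    Real.exp (-(((x.1 - μ₁) / σ₁) ^ 2 - 2 * ρ * ((x.1 - μ₁) / σ₁) * ((x.2 - μ₂) / σ₂) +
      ((x.2 - μ₂) / σ₂) ^ 2) / (2 * (1 - ρ ^ 2)))

/-- The bivariate normal law. -/
def normalLaw (μ₁ μ₂ σ₁ σ₂ ρ : ℝ) : Measure (ℝ × ℝ) :=
  volume.withDensity fun x => ENNReal.ofReal (normalPDF μ₁ μ₂ σ₁ σ₂ ρ x)

/-- Law of an independent sample of size `n` from the bivariate normal law. -/
def sampleLaw (n : ℕ) (μ₁ μ₂ σ₁ σ₂ ρ : ℝ) : Measure (Fin n → ℝ × ℝ) :=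
  Measure.pi fun _ => normalLaw μ₁ μ₂ σ₁ σ₂ ρ

/-- The parameters `(μ₁, μ₂, σ₁, σ₂, ρ)`. -/
abbrev Param : Type := ℝ × ℝ × ℝ × ℝ × ℝ

/-- The parameter space: `σ₁ > 0`, `σ₂ > 0`, `|ρ| < 1`. -/
def paramSpace : Set Param :=
  {p | 0 < p.2.2.1 ∧ 0 < p.2.2.2.1 ∧ |p.2.2.2.2| < 1}

/-- Likelihood of the parameter `p` given the sample `X`. -/
def likelihood {n : ℕ} (X : Fin n → ℝ × ℝ) (p : Param) : ℝ :=
  ∏ k, normalPDF p.1 p.2.1 p.2.2.1 p.2.2.2.1 p.2.2.2.2 (X k)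

/-- `θ₄ = σ₂ √(1 - ρ²) / σ₁`. -/
def theta4 (p : Param) : ℝ := p.2.2.2.1 * √(1 - p.2.2.2.2 ^ 2) / p.2.2.1

/-! ### Sample statistics -/

/-- Sample mean. -/
def mean {n : ℕ} (x : Fin n → ℝ) : ℝ := (∑ k, x k) / n

/-- Sum of products of deviations from the sample means. -/
def devSum {n : ℕ} (x y : Fin n → ℝ) : ℝ := ∑ k, (x k - mean x) * (y k - mean y)

/-- `s₁₁`. -/
def s11 {n : ℕ} (X : Fin n → ℝ × ℝ) : ℝ := devSum (fun k => (X k).1) (fun k => (X k).1)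

/-- `s₁₂`. -/
def s12 {n : ℕ} (X : Fin n → ℝ × ℝ) : ℝ := devSum (fun k => (X k).1) (fun k => (X k).2)

/-- `s₂₂`. -/
def s22 {n : ℕ} (X : Fin n → ℝ × ℝ) : ℝ := devSum (fun k => (X k).2) (fun k => (X k).2)

/-- The sample correlation coefficient. -/
def corr {n : ℕ} (X : Fin n → ℝ × ℝ) : ℝ := s12 X / √(s11 X * s22 X)

/-! ### Prior and posterior -/

/-- The (improper) prior density `π_ab` with respect to `dμ₁ dμ₂ dσ₁ dσ₂ dρ`. -/
def priorDensity (a b : ℝ) (p : Param) : ℝ :=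
  1 / (p.2.2.1 ^ (3 - a) * p.2.2.2.1 ^ (2 - b) * (1 - p.2.2.2.2 ^ 2) ^ (2 - b / 2))

/-- The measure on the parameter space with density prior times likelihood. -/
def jointMeasure (a b : ℝ) {n : ℕ} (X : Fin n → ℝ × ℝ) : Measure Param :=
  (volume.restrict paramSpace).withDensity fun p =>
    ENNReal.ofReal (priorDensity a b p * likelihood X p)

/-- The posterior distribution of `(μ₁, μ₂, σ₁, σ₂, ρ)` given `X` under the prior `π_ab`. -/
def posterior (a b : ℝ) {n : ℕ} (X : Fin n → ℝ × ℝ) : Measure Param :=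
  (jointMeasure a b X univ)⁻¹ • jointMeasure a b X

/-! ### Chi-squared laws and quantiles -/

/-- The chi-squared law with `ν > 0` (not necessarily integral) degrees of freedom. -/
def chiSquared (ν : ℝ) : Measure ℝ := gammaMeasure (ν / 2) (1 / 2)

/-- Joint law of independent chi-squared variables with `ν₁` and `ν₂` degrees of freedom. -/
def chiSquaredPair (ν₁ ν₂ : ℝ) : Measure (ℝ × ℝ) := (chiSquared ν₁).prod (chiSquared ν₂)

/-- The `p`-quantile of a law on the real line. -/
def quantile (m : Measure ℝ) (p : ℝ) : ℝ := sInf {x | p ≤ m.real (Iic x)}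

/-- The one-sided credible interval for `θ₄` from the lower boundary `0` of the range of `θ₄` to the
posterior `1 - α` quantile of `θ₄`. -/
def credibleInterval (a b α : ℝ) {n : ℕ} (X : Fin n → ℝ × ℝ) : Set ℝ :=
  Ioo 0 (quantile ((posterior a b X).map theta4) (1 - α))

/-- Frequentist coverage probability of the credible interval at the parameter `p`. -/
def coverage (a b α : ℝ) (n : ℕ) (p : Param) : ENNReal :=
  sampleLaw n p.1 p.2.1 p.2.2.1 p.2.2.2.1 p.2.2.2.2 {X | theta4 p ∈ credibleInterval a b α X}

end BivariateNormal

end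

noncomputable section

namespace BivariateNormal

/-! ### The chi-squared law -/

/-! Everything rests on the regression parametrization `β = ρ σ₂ / σ₁`, `τ = σ₂ √(1 - ρ²)`, in which
`θ₄ = τ / σ₁`. With `rss = s₂₂ (1 - r²)`, the residual sum of squares, consider the pair `(s₁₁ /
σ₁², rss / τ²)` and the ratio `T` of its entries. Then `θ₄ < √t √(rss / s₁₁)` if and only if `T <
t`, so the posterior statement and the coverage statement both concern the law of `T`, once with the
data fixed and once with the parameters fixed.

Data fixed (`exists_lintegral_jointMeasure_eq`): completing squares makes the likelihood Gaussian in
`μ₂`, `μ₁` and `β`, and the prior divided by the Jacobian of `(σ₂, ρ) ↦ (β, τ)` is `σ₁^(a-2)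
τ^(b-3)`. Integrating out `μ₂`, `μ₁`, `β` leaves a product of kernels in `σ₁` and `τ`, which says
that the pair is distributed as independent chi-squared variables with `n - a` and `n - b` degrees
of freedom. Finiteness of the constant is properness.

Parameters fixed (`sampleLaw_map`): the sample is an affine image of two independent standard
Gaussian vectors, and the pair consists of squared norms of projections onto spaces of dimensions `n
- 1` and `n - 2`. The second law, conditional on the first vector, does not depend on that vector;
hence independence.

Exact coverage at all levels forces the two ratio laws to agree, because neither has atoms
(`eq_of_measure_Iio_quantile`). The degrees of freedom can be read off a ratio law as the exponents
at which its moments diverge (`ratioLaw_inj`), so `n - a = n - 1` and `n - b = n - 2`. -/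

lemma isProbabilityMeasure_chiSquared {ν : ℝ} (hν : 0 < ν) :
    IsProbabilityMeasure (chiSquared ν) :=
  isProbabilityMeasure_gammaMeasure (by positivity) (by norm_num)

lemma lintegral_chiSquared (ν : ℝ) {h : ℝ → ENNReal} (hh : Measurable h) :
    ∫⁻ u, h u ∂chiSquared ν = ∫⁻ u in Ioi 0, gammaPDF (ν / 2) (1 / 2) u * h u := by
  have hm : Measurable (gammaPDF (ν / 2) (1 / 2)) :=
    (measurable_gammaPDFReal _ _).ennreal_ofReal
  rw [chiSquared, gammaMeasure, lintegral_withDensity_eq_lintegral_mul _ hm hh,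
    ← lintegral_add_compl _ measurableSet_Ici,
    setLIntegral_congr (Ioi_ae_eq_Ici (a := (0 : ℝ))).symm]
  simp only [Pi.mul_apply, compl_Ici]
  rw [setLIntegral_congr_fun (g := fun _ => 0) measurableSet_Iio, lintegral_zero, add_zero]
  intro u hu
  simp [gammaPDF_of_neg (mem_Iio.1 hu)]

lemma image_const_mul_rpow_Ioi {s p : ℝ} (hs : 0 < s) (hp : p ≠ 0) :
    (fun r : ℝ => s * r ^ p) '' Ioi 0 = Ioi 0 := by
  ext u
  simp only [mem_image, mem_Ioi]
  constructor
  · rintro ⟨r, hr, rfl⟩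
    positivity
  · intro hu
    refine ⟨(u / s) ^ p⁻¹, by positivity, ?_⟩
    rw [← Real.rpow_mul (by positivity), inv_mul_cancel₀ hp, Real.rpow_one]
    field_simp

lemma injOn_const_mul_rpow_Ioi {s p : ℝ} (hs : 0 < s) (hp : p ≠ 0) :
    InjOn (fun r : ℝ => s * r ^ p) (Ioi 0) := by
  intro x hx y hy hxy
  have h := mul_left_cancel₀ hs.ne' hxy
  exact Real.rpow_left_injOn hp (mem_Ioi.1 hx).le (mem_Ioi.1 hy).le h

/-- The substitution `u = s r ^ p` in an integral against the chi-squared law. -/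
lemma exists_lintegral_rpow_mul_exp_eq {ν s p : ℝ} (hν : 0 < ν) (hs : 0 < s) (hp : p ≠ 0) :
    ∃ C : ENNReal, C ≠ 0 ∧ C ≠ ⊤ ∧ ∀ h : ℝ → ENNReal, Measurable h →
      ∫⁻ r in Ioi 0, ENNReal.ofReal (r ^ (p * ν / 2 - 1) * Real.exp (-(s * r ^ p) / 2)) *
        h (s * r ^ p) = C * ∫⁻ u, h u ∂chiSquared ν := by
  -- `K` collects the normalization of the gamma density, the factor `|p|` of the Jacobian, and the
  -- powers of `s` from both; the powers of `r` make up the kernel.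
  set K : ℝ := (1 / 2) ^ (ν / 2) / Real.Gamma (ν / 2) * |p| * s ^ (ν / 2) with hK
  have hK0 : 0 < K := by
    have := Real.Gamma_pos_of_pos (half_pos hν)
    have := abs_pos.2 hp
    positivity
  refine ⟨(ENNReal.ofReal K)⁻¹, by simp, by simpa using hK0, fun h hh => ?_⟩
  have hsub := lintegral_image_eq_lintegral_abs_deriv_mul (f' := fun r => s * (p * r ^ (p - 1)))
    measurableSet_Ioi
    (fun r hr => ((Real.hasDerivAt_rpow_const (Or.inl (ne_of_gt hr))).const_mul s).hasDerivWithinAt)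
    (injOn_const_mul_rpow_Ioi hs hp) (fun u => gammaPDF (ν / 2) (1 / 2) u * h u)
  rw [image_const_mul_rpow_Ioi hs hp] at hsub
  rw [lintegral_chiSquared ν hh, hsub, ← lintegral_const_mul' _ _ (by simpa using hK0)]
  refine setLIntegral_congr_fun measurableSet_Ioi fun r hr => ?_
  have hr : 0 < r := hr
  rw [gammaPDF_of_nonneg (by positivity), ← mul_assoc, ← mul_assoc]
  congr 1
  rw [← ENNReal.ofReal_inv_of_pos hK0, ← ENNReal.ofReal_mul (by positivity),
    ← ENNReal.ofReal_mul (by positivity)]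
  congr 1
  have e1 : |s * (p * r ^ (p - 1))| = s * |p| * r ^ (p - 1) := by
    rw [abs_mul, abs_mul, abs_of_pos hs, abs_of_pos (Real.rpow_pos_of_pos hr _)]; ring
  have e2 : (s * r ^ p) ^ (ν / 2 - 1) = s ^ (ν / 2) / s * (r ^ (p * ν / 2) / r ^ p) := by
    rw [Real.mul_rpow hs.le (by positivity), Real.rpow_sub_one hs.ne', ← Real.rpow_mul hr.le,
      ← Real.rpow_sub hr]
    congr 2; ring
  rw [e1, e2, Real.rpow_sub_one hr.ne', Real.rpow_sub_one hr.ne', hK,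
    show -(s * r ^ p) / 2 = -(1 / 2 * (s * r ^ p)) by ring]
  have : 0 < r ^ p := by positivity
  have := Real.Gamma_pos_of_pos (half_pos hν)
  have := abs_pos.2 hp
  field_simp

/-! ### Standard Gaussian vectors -/

section StdGaussian

variable {E : Type*} [NormedAddCommGroup E] [InnerProductSpace ℝ E] [FiniteDimensional ℝ E]
  [MeasurableSpace E] [BorelSpace E]

/-- Polar coordinates; the constant is the total mass of the sphere, whose value is never needed. -/
lemma exists_lintegral_norm_eq [Nontrivial E] :
    ∃ C : ENNReal, ∀ f : ℝ → ENNReal, Measurable f →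
      ∫⁻ x : E, f ‖x‖ = C * ∫⁻ r in Ioi (0 : ℝ),
        ENNReal.ofReal (r ^ (Module.finrank ℝ E - 1)) * f r := by
  refine ⟨(volume : Measure E).toSphere univ, fun f hf => ?_⟩
  have h1 : ∫⁻ x : E, f ‖x‖ =
      ∫⁻ x : ({(0 : E)}ᶜ : Set E), f ‖x.1‖ ∂((volume : Measure E).comap (↑)) := by
    rw [lintegral_subtype_comap (measurableSet_singleton (0 : E)).compl fun x => f ‖x‖,
      restrict_compl_singleton]
  have h2 := (volume : Measure E).measurePreserving_homeomorphUnitSphereProd.lintegral_comp_emb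
    (Homeomorph.measurableEmbedding _) (fun x => f x.2.1)
  simp only [homeomorphUnitSphereProd_apply_snd_coe] at h2
  rw [h1, h2, lintegral_prod _ (by fun_prop)]
  simp only [lintegral_const]
  rw [mul_comm, Measure.volumeIoiPow, lintegral_withDensity_eq_lintegral_mul _ (by fun_prop)
    (by fun_prop)]
  congr 1
  exact lintegral_subtype_comap measurableSet_Ioi
    (fun r : ℝ => ENNReal.ofReal (r ^ (Module.finrank ℝ E - 1)) * f r)

lemma integrable_exp_neg_half_sq_norm :
    Integrable fun x : E => Real.exp (-‖x‖ ^ 2 / 2) := by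
  have h := (GaussianFourier.integrable_cexp_neg_mul_sq_norm_add (V := E) (b := 1 / 2)
    (by norm_num) 0 0).re
  refine h.congr (ae_of_all _ fun x => ?_)
  have : (-(1 / 2) * (‖x‖ : ℂ) ^ 2 + 0 * (inner ℝ (0 : E) x : ℝ)) =
      ((-‖x‖ ^ 2 / 2 : ℝ) : ℂ) := by
    push_cast; ring
  simp only [this]
  exact Complex.exp_ofReal_re _

variable (E) in
-- Both measures have the same characteristic function, by the Fourier transform of the Gaussian;
-- `c` is the normalizing constant.
lemma exists_stdGaussian_eq_withDensity :
    ∃ c : ℝ, stdGaussian E =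
      (volume : Measure E).withDensity fun x => ENNReal.ofReal (c * Real.exp (-‖x‖ ^ 2 / 2)) := by
  set c : ℝ := (∫ x : E, Real.exp (-‖x‖ ^ 2 / 2))⁻¹ with hc
  have hc0 : 0 ≤ c := inv_nonneg.2 (integral_nonneg fun x => by positivity)
  refine ⟨c, ?_⟩
  have hint := (integrable_exp_neg_half_sq_norm (E := E)).const_mul c
  have := isFiniteMeasure_withDensity_ofReal hint.2
  refine Measure.ext_of_charFun ?_
  ext t
  rw [charFun_stdGaussian, charFun_apply, integral_withDensity_eq_integral_toReal_smul
    (by fun_prop) (by simp)]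
  have e1 := GaussianFourier.integral_cexp_neg_mul_sq_norm_add (V := E) (b := 1 / 2)
    (by norm_num) Complex.I t
  have e2 := GaussianFourier.integral_cexp_neg_mul_sq_norm_add (V := E) (b := 1 / 2)
    (by norm_num) 0 0
  have e3 : ∀ x : E, (ENNReal.ofReal (c * Real.exp (-‖x‖ ^ 2 / 2))).toReal •
      Complex.exp ((inner ℝ x t : ℝ) * Complex.I) =
      c * Complex.exp (-(1 / 2) * (‖x‖ : ℂ) ^ 2 + Complex.I * (inner ℝ t x : ℝ)) := by
    intro x
    rw [ENNReal.toReal_ofReal (by positivity), Complex.exp_add, Complex.real_smul,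
      real_inner_comm]
    push_cast
    rw [show (-(‖x‖ : ℂ) ^ 2 / 2) = -(1 / 2) * (‖x‖ : ℂ) ^ 2 by ring, mul_assoc, mul_comm Complex.I]
  simp_rw [e3]
  rw [integral_const_mul, e1]
  -- The Fourier formula at frequency `0` evaluates the normalizing integral, so the prefactor in
  -- `e1` is `c⁻¹`.
  have e4 : ((c⁻¹ : ℝ) : ℂ) = (Real.pi / (1 / 2 : ℂ)) ^ (Module.finrank ℝ E / 2 : ℂ) := by
    rw [hc, inv_inv, ← integral_complex_ofReal]
    simp only [inner_zero_left, Complex.ofReal_zero, mul_zero, add_zero] at e2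
    rw [show (fun x : E => ((Real.exp (-‖x‖ ^ 2 / 2) : ℝ) : ℂ)) =
      fun x : E => Complex.exp (-(1 / 2) * (‖x‖ : ℂ) ^ 2) by
        ext x; push_cast; congr 1; ring, e2]
    simp
  have hc1 : (c : ℂ) ≠ 0 := by
    intro h0
    rw [Complex.ofReal_eq_zero] at h0
    rw [h0, eq_comm, inv_zero, Complex.ofReal_zero, Complex.cpow_eq_zero_iff] at e4
    simp at e4
  rw [← e4]
  push_cast
  rw [mul_inv_cancel_left₀ hc1]
  congr 1
  rw [Complex.I_sq]
  ring

/-- The squared norm of a standard Gaussian vector has a chi-squared law. -/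
lemma stdGaussian_map_sq_norm [Nontrivial E] :
    (stdGaussian E).map (fun x => ‖x‖ ^ 2) = chiSquared (Module.finrank ℝ E) := by
  have hd : 0 < Module.finrank ℝ E := Module.finrank_pos
  have hd' : (0 : ℝ) < Module.finrank ℝ E := by exact_mod_cast hd
  obtain ⟨c, hc⟩ := exists_stdGaussian_eq_withDensity E
  obtain ⟨C, hC⟩ := exists_lintegral_norm_eq (E := E)
  obtain ⟨D, -, -, hD⟩ := exists_lintegral_rpow_mul_exp_eq hd' one_pos two_ne_zero
  have key : ∀ h : ℝ → ENNReal, Measurable h → ∫⁻ x, h (‖x‖ ^ 2) ∂stdGaussian E =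
      ENNReal.ofReal c * C * D * ∫⁻ u, h u ∂chiSquared (Module.finrank ℝ E) := by
    intro h hh
    rw [hc, lintegral_withDensity_eq_lintegral_mul _ (by fun_prop) (by fun_prop)]
    simp only [Pi.mul_apply]
    rw [hC (fun r => ENNReal.ofReal (c * Real.exp (-r ^ 2 / 2)) * h (r ^ 2)) (by fun_prop),
      mul_assoc _ D, ← hD h hh, mul_comm (ENNReal.ofReal c), mul_assoc,
      ← lintegral_const_mul' (ENNReal.ofReal c) _ (by simp)]
    congr 1
    refine setLIntegral_congr_fun measurableSet_Ioi fun r hr => ?_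
    have hr : 0 < r := hr
    rw [ENNReal.ofReal_mul' (by positivity), ENNReal.ofReal_mul (by positivity),
      show (2 : ℝ) * Module.finrank ℝ E / 2 - 1 = ((Module.finrank ℝ E - 1 : ℕ) : ℝ) by
        rw [Nat.cast_sub hd]; simp,
      Real.rpow_natCast, one_mul, show r ^ (2 : ℝ) = r ^ 2 by norm_cast]
    ring
  have := isProbabilityMeasure_chiSquared hd'
  -- Both laws are probability measures, so testing with `1` shows that the unknown constants
  -- multiply to `1`.
  have h1 := key (fun _ => 1) measurable_const
  simp only [lintegral_const, measure_univ, mul_one] at h1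
  ext s hs
  have h2 := key (s.indicator 1) (measurable_one.indicator hs)
  rw [← h1, one_mul, lintegral_indicator_one hs] at h2
  rw [← lintegral_indicator_one hs, lintegral_map (measurable_one.indicator hs) (by fun_prop), h2]

/-- The orthogonal projection of a standard Gaussian vector is a standard Gaussian vector. -/
lemma stdGaussian_map_orthogonalProjection (V : Submodule ℝ E) :
    (stdGaussian E).map V.orthogonalProjectionOnto = stdGaussian V := by
  have : IsProbabilityMeasure ((stdGaussian E).map V.orthogonalProjectionOnto) :=
    Measure.isProbabilityMeasure_map (by fun_prop)
  refine Measure.ext_of_charFun ?_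
  ext t
  rw [charFun_stdGaussian, charFun_apply, integral_map (by fun_prop) (by fun_prop)]
  have := charFun_stdGaussian (E := E) (t : E)
  rw [charFun_apply] at this
  simpa using this

lemma stdGaussian_map_sq_norm_orthogonalProjection {V : Submodule ℝ E} {d : ℕ}
    (hV : Module.finrank ℝ V = d) (hd : 0 < d) :
    (stdGaussian E).map (fun x => ‖V.orthogonalProjectionOnto x‖ ^ 2) = chiSquared d := by
  have : Nontrivial V := Module.nontrivial_of_finrank_pos (R := ℝ) (hV ▸ hd)
  rw [← hV, ← stdGaussian_map_sq_norm, ← stdGaussian_map_orthogonalProjection V,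
    Measure.map_map (by fun_prop) (by fun_prop)]
  rfl

end StdGaussian

/-! ### Algebra of the sample statistics -/

section DevSum

variable {n : ℕ}

lemma devSum_comm (x y : Fin n → ℝ) : devSum x y = devSum y x := by
  simp only [devSum, mul_comm]

lemma devSum_self_nonneg (x : Fin n → ℝ) : 0 ≤ devSum x x :=
  Finset.sum_nonneg fun _ _ => mul_self_nonneg _

lemma mean_affine (hn : n ≠ 0) (c s t : ℝ) (x y : Fin n → ℝ) :
    mean (fun k => c + s * x k + t * y k) = c + s * mean x + t * mean y := by
  have : (n : ℝ) ≠ 0 := by exact_mod_cast hn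
  simp only [mean, Finset.sum_add_distrib, ← Finset.mul_sum, Finset.sum_const, Finset.card_univ,
    Fintype.card_fin, nsmul_eq_mul]
  field_simp

lemma devSum_affine_left (hn : n ≠ 0) (c s t : ℝ) (x y w : Fin n → ℝ) :
    devSum (fun k => c + s * x k + t * y k) w = s * devSum x w + t * devSum y w := by
  simp only [devSum, mean_affine hn, Finset.mul_sum, ← Finset.sum_add_distrib]
  exact Finset.sum_congr rfl fun k _ => by ring

lemma devSum_affine_right (hn : n ≠ 0) (c s t : ℝ) (x y w : Fin n → ℝ) :
    devSum w (fun k => c + s * x k + t * y k) = s * devSum w x + t * devSum w y := by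
  rw [devSum_comm, devSum_affine_left hn, devSum_comm x, devSum_comm y]

lemma sum_sub_mean (x : Fin n → ℝ) : ∑ k, (x k - mean x) = 0 := by
  rcases eq_or_ne n 0 with rfl | hn
  · simp
  have : (n : ℝ) ≠ 0 := by exact_mod_cast hn
  simp only [mean, Finset.sum_sub_distrib, Finset.sum_const, Finset.card_univ, Fintype.card_fin,
    nsmul_eq_mul]
  field_simp
  ring

/-- The residual sum of squares in the linear regression of `y` on `x`. -/
def residualSum (x y : Fin n → ℝ) : ℝ := devSum y y - devSum x y ^ 2 / devSum x x

lemma devSum_affine_self (hn : n ≠ 0) (c s : ℝ) (x : Fin n → ℝ) :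
    devSum (fun k => c + s * x k) (fun k => c + s * x k) = s ^ 2 * devSum x x := by
  have e : (fun k => c + s * x k) = fun k => c + s * x k + 0 * x k := by ext k; ring
  rw [e, devSum_affine_left hn, devSum_affine_right hn]
  ring

/-- Residuals ignore any affine function of `x` added to the response and any rescaling of the
regressor. This is why `ρ` enters the law of `rss` only through the scale `σ₂ √(1 - ρ²)`. -/
lemma residualSum_affine (hn : n ≠ 0) (c c' s' t : ℝ) {s : ℝ} {x : Fin n → ℝ} (hs : s ≠ 0)
    (hx : devSum x x ≠ 0) (y : Fin n → ℝ) :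
    residualSum (fun k => c + s * x k) (fun k => c' + s' * x k + t * y k) =
      t ^ 2 * residualSum x y := by
  have e : (fun k => c + s * x k) = fun k => c + s * x k + 0 * x k := by ext k; ring
  have h12 : devSum (fun k => c + s * x k) (fun k => c' + s' * x k + t * y k) =
      s * (s' * devSum x x + t * devSum x y) := by
    rw [e, devSum_affine_left hn, devSum_affine_right hn]
    ring
  rw [residualSum, residualSum, devSum_affine_self hn, h12, devSum_affine_left hn,
    devSum_affine_right hn, devSum_affine_right hn, devSum_comm y x]
  field_simp
  ring

lemma measurable_devSum : Measurable fun z : (Fin n → ℝ) × (Fin n → ℝ) => devSum z.1 z.2 := by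
  unfold devSum mean
  fun_prop

lemma measurable_residualSum :
    Measurable fun z : (Fin n → ℝ) × (Fin n → ℝ) => residualSum z.1 z.2 := by
  unfold residualSum devSum mean
  fun_prop

end DevSum

/-! ### Laws of sums of squares for standard normal samples -/

section StandardSample

variable {n : ℕ}

/-- Law of a sample of size `n` from the standard normal law. -/
def stdSample (n : ℕ) : Measure (Fin n → ℝ) := Measure.pi fun _ => gaussianReal 0 1

instance : IsProbabilityMeasure (stdSample n) := by unfold stdSample; infer_instance

lemma stdSample_map_sq_norm_orthogonalProjection {V : Submodule ℝ (EuclideanSpace ℝ (Fin n))}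
    {d : ℕ} (hV : Module.finrank ℝ V = d) (hd : 0 < d) :
    (stdSample n).map (fun x => ‖V.orthogonalProjectionOnto (WithLp.toLp 2 x)‖ ^ 2) =
      chiSquared d := by
  rw [← stdGaussian_map_sq_norm_orthogonalProjection hV hd, ← map_pi_eq_stdGaussian,
    Measure.map_map (by fun_prop) (by fun_prop)]
  rfl

/-- Serves to recognize a centred vector or a vector of residuals as an orthogonal projection. -/
lemma norm_orthogonalProjectionOnto_orthogonal {E : Type*} [NormedAddCommGroup E]
    [InnerProductSpace ℝ E] [FiniteDimensional ℝ E] {U : Submodule ℝ E} {y r : E}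
    (hr : r ∈ Uᗮ) (hyr : y - r ∈ U) : ‖Uᗮ.orthogonalProjectionOnto y‖ = ‖r‖ := by
  have h : Uᗮ.starProjection y = r :=
    (Submodule.eq_starProjection_of_mem_orthogonal hr
      (by rwa [Submodule.orthogonal_orthogonal]))
  rw [← h]
  simp

lemma inner_toLp_toLp (x y : Fin n → ℝ) :
    inner ℝ (WithLp.toLp 2 x : EuclideanSpace ℝ (Fin n)) (WithLp.toLp 2 y) = ∑ k, x k * y k := by
  simp [PiLp.inner_apply, mul_comm]

lemma sq_norm_toLp (x : Fin n → ℝ) :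
    ‖(WithLp.toLp 2 x : EuclideanSpace ℝ (Fin n))‖ ^ 2 = ∑ k, x k * x k := by
  rw [← real_inner_self_eq_norm_sq, inner_toLp_toLp]

/-- Centring is the projection onto the orthogonal complement of the constant vectors, of dimension
`n - 1`. -/
lemma stdSample_map_devSum (hn : 2 ≤ n) :
    (stdSample n).map (fun x => devSum x x) = chiSquared (n - 1) := by
  set e : EuclideanSpace ℝ (Fin n) := WithLp.toLp 2 fun _ => 1 with he
  have he0 : e ≠ 0 := by
    intro h
    have := congrArg (fun v : EuclideanSpace ℝ (Fin n) => v ⟨0, by omega⟩) h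
    simp [he] at this
  have hfin : Module.finrank ℝ (ℝ ∙ e)ᗮ = n - 1 := by
    have h := Submodule.finrank_add_finrank_orthogonal (ℝ ∙ e)
    rw [finrank_span_singleton he0, finrank_euclideanSpace_fin] at h
    omega
  have h := stdSample_map_sq_norm_orthogonalProjection hfin (by omega)
  rw [Nat.cast_sub (by omega), Nat.cast_one] at h
  rw [← h]
  congr 1
  ext x
  rw [norm_orthogonalProjectionOnto_orthogonal (r := WithLp.toLp 2 fun k => x k - mean x),
    sq_norm_toLp, devSum]
  · rw [Submodule.mem_orthogonal_singleton_iff_inner_left, inner_toLp_toLp]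
    simpa using sum_sub_mean x
  · refine Submodule.mem_span_singleton.2 ⟨mean x, ?_⟩
    ext k
    simp [he]

/-- The least-squares residuals are the projection of the response onto the orthogonal complement of
the span of `1` and `x`. That span is a plane because `devSum x x ≠ 0` prevents `x` from being
constant. -/
lemma stdSample_map_residualSum (hn : 3 ≤ n) {x : Fin n → ℝ} (hx : devSum x x ≠ 0) :
    (stdSample n).map (residualSum x) = chiSquared (n - 2) := by
  set e : EuclideanSpace ℝ (Fin n) := WithLp.toLp 2 fun _ => 1 with he
  have he0 : e ≠ 0 := by
    intro h
    have := congrArg (fun v : EuclideanSpace ℝ (Fin n) => v ⟨0, by omega⟩) h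
    simp [he] at this
  have hn0 : (n : ℝ) ≠ 0 := by norm_cast; omega
  have hind : LinearIndependent ℝ ![e, WithLp.toLp 2 x] := by
    rw [LinearIndependent.pair_iff' he0]
    intro c hc
    apply hx
    have hxc : x = fun _ => c := by
      ext k
      have := congrArg (fun v : EuclideanSpace ℝ (Fin n) => v k) hc
      simpa [he] using this.symm
    rw [hxc]
    simp [devSum, mean, hn0]
  have hfin : Module.finrank ℝ (Submodule.span ℝ {e, WithLp.toLp 2 x})ᗮ = n - 2 := by
    have h := Submodule.finrank_add_finrank_orthogonal (Submodule.span ℝ {e, WithLp.toLp 2 x})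
    have h2 := finrank_span_eq_card hind
    rw [Matrix.range_cons_cons_empty] at h2
    rw [h2, finrank_euclideanSpace_fin, Fintype.card_fin] at h
    omega
  have h := stdSample_map_sq_norm_orthogonalProjection hfin (by omega)
  rw [Nat.cast_sub (by omega), Nat.cast_ofNat] at h
  rw [← h]
  congr 1
  ext y
  -- The least-squares slope, which makes the residuals orthogonal to `x`.
  set β : ℝ := devSum x y / devSum x x with hβ
  have hβx : β * devSum x x = devSum x y := div_mul_cancel₀ _ hx
  have hsum : ∑ k, (y k - mean y - β * (x k - mean x)) = 0 := by
    rw [Finset.sum_sub_distrib, ← Finset.mul_sum, sum_sub_mean, sum_sub_mean]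
    ring
  rw [norm_orthogonalProjectionOnto_orthogonal
    (r := WithLp.toLp 2 fun k => y k - mean y - β * (x k - mean x)), sq_norm_toLp]
  · have : ∑ k, (y k - mean y - β * (x k - mean x)) * (y k - mean y - β * (x k - mean x)) =
        devSum y y - 2 * β * devSum x y + β ^ 2 * devSum x x := by
      simp only [devSum, Finset.mul_sum, ← Finset.sum_sub_distrib, ← Finset.sum_add_distrib]
      exact Finset.sum_congr rfl fun k _ => by ring
    rw [this, residualSum, hβ]
    field_simp
    ring
  · rw [Submodule.mem_orthogonal]
    intro u hu
    obtain ⟨a, b, rfl⟩ := Submodule.mem_span_pair.1 hu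
    rw [inner_add_left, inner_smul_left, inner_smul_left, inner_toLp_toLp, inner_toLp_toLp]
    have h2 : ∑ k, x k * (y k - mean y - β * (x k - mean x)) = 0 := by
      have : ∑ k, x k * (y k - mean y - β * (x k - mean x)) =
          ∑ k, ((x k - mean x) * (y k - mean y) - β * ((x k - mean x) * (x k - mean x))) +
            mean x * ∑ k, (y k - mean y - β * (x k - mean x)) := by
        rw [Finset.mul_sum, ← Finset.sum_add_distrib]
        exact Finset.sum_congr rfl fun k _ => by ring
      rw [this, hsum, Finset.sum_sub_distrib, ← Finset.mul_sum]
      change devSum x y - β * devSum x x + _ = 0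
      rw [hβx]
      ring
    simp [h2, hsum]
  · refine Submodule.mem_span_pair.2 ⟨mean y - β * mean x, β, ?_⟩
    ext k
    simp [he]
    ring

instance {ν : ℝ} : NullSingletonClass (chiSquared ν) := by
  unfold chiSquared gammaMeasure
  infer_instance

lemma chiSquared_ae_pos (ν : ℝ) : ∀ᵐ u ∂chiSquared ν, 0 < u := by
  have h : ∀ᵐ u ∂chiSquared ν, 0 ≤ u := by
    have hm : Measurable (gammaPDF (ν / 2) (1 / 2)) :=
      (measurable_gammaPDFReal _ _).ennreal_ofReal
    rw [chiSquared, gammaMeasure, ae_withDensity_iff hm]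
    refine ae_of_all _ fun u hu => ?_
    by_contra! h
    exact hu (gammaPDF_of_neg h)
  have h0 : ∀ᵐ u ∂chiSquared ν, u ≠ 0 := by
    simp [ae_iff]
  filter_upwards [h, h0] with u hu hu0 using lt_of_le_of_ne hu hu0.symm

lemma isProbabilityMeasure_chiSquaredPair {ν₁ ν₂ : ℝ} (h₁ : 0 < ν₁) (h₂ : 0 < ν₂) :
    IsProbabilityMeasure (chiSquaredPair ν₁ ν₂) := by
  have := isProbabilityMeasure_chiSquared h₁
  have := isProbabilityMeasure_chiSquared h₂
  unfold chiSquaredPair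
  infer_instance

lemma ae_chiSquaredPair_pos {ν₁ ν₂ : ℝ} (h₁ : 0 < ν₁) (h₂ : 0 < ν₂) :
    ∀ᵐ u ∂chiSquaredPair ν₁ ν₂, 0 < u.1 ∧ 0 < u.2 := by
  have := isProbabilityMeasure_chiSquared h₁
  have := isProbabilityMeasure_chiSquared h₂
  filter_upwards [Measure.quasiMeasurePreserving_fst.ae (chiSquared_ae_pos ν₁),
    Measure.quasiMeasurePreserving_snd.ae (chiSquared_ae_pos ν₂)] with u h1 h2 using ⟨h1, h2⟩

lemma ae_stdSample_devSum_ne_zero (hn : 2 ≤ n) : ∀ᵐ x ∂stdSample n, devSum x x ≠ 0 := by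
  have h := chiSquared_ae_pos ((n : ℝ) - 1)
  rw [← stdSample_map_devSum hn] at h
  have hm : Measurable fun x : Fin n → ℝ => devSum x x :=
    measurable_devSum.comp (measurable_id.prodMk measurable_id)
  filter_upwards [ae_of_ae_map hm.aemeasurable h] with x hx using hx.ne'

/-- For two independent standard normal samples, the sum of squares of the first one and the
residual sum of squares of the second one given the first are independent chi-squared variables. -/
lemma stdSample_prod_map (hn : 3 ≤ n) :
    ((stdSample n).prod (stdSample n)).map (fun z => (devSum z.1 z.1, residualSum z.1 z.2)) =
      chiSquaredPair (n - 1) (n - 2) := by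
  have hn' : (3 : ℝ) ≤ n := by exact_mod_cast hn
  have := isProbabilityMeasure_chiSquared (ν := n - 1) (by linarith)
  have := isProbabilityMeasure_chiSquared (ν := n - 2) (by linarith)
  have hm : Measurable fun x : Fin n → ℝ => devSum x x :=
    measurable_devSum.comp (measurable_id.prodMk measurable_id)
  have hm2 : Measurable fun z : (Fin n → ℝ) × (Fin n → ℝ) =>
      (devSum z.1 z.1, residualSum z.1 z.2) :=
    (hm.comp measurable_fst).prodMk measurable_residualSum
  refine Measure.ext_of_lintegral _ fun f hf => ?_
  rw [lintegral_map hf hm2, lintegral_prod _ (by fun_prop), chiSquaredPair,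
    lintegral_prod _ (by fun_prop), ← stdSample_map_devSum (by omega : 2 ≤ n),
    lintegral_map hf.lintegral_prod_right' hm]
  -- For almost every first sample the conditional law of the residual sum is the same chi-squared
  -- law, which gives independence.
  refine lintegral_congr_ae ?_
  filter_upwards [ae_stdSample_devSum_ne_zero (by omega : 2 ≤ n)] with x hx
  have hm3 : Measurable (residualSum x) :=
    measurable_residualSum.comp (measurable_const.prodMk measurable_id)
  rw [← stdSample_map_residualSum hn hx, lintegral_map (by fun_prop) hm3]

end StandardSample

/-! ### The sampling law -/

lemma lintegral_gaussianReal_affine (m : ℝ) {s : ℝ} (hs : 0 < s) {f : ℝ → ENNReal}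
    (hf : Measurable f) :
    ∫⁻ z, f (m + s * z) ∂gaussianReal 0 1 =
      ∫⁻ x, ENNReal.ofReal ((√(2 * Real.pi) * s)⁻¹ * Real.exp (-(x - m) ^ 2 / (2 * s ^ 2))) *
        f x := by
  have hmap : (gaussianReal 0 1).map (fun z => m + s * z) =
      gaussianReal m (NNReal.mk (s ^ 2) (sq_nonneg s)) := by
    rw [show (fun z => m + s * z) = (fun z => m + z) ∘ (fun z => s * z) from rfl,
      ← Measure.map_map (by fun_prop) (by fun_prop), gaussianReal_map_const_mul,
      gaussianReal_map_const_add]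
    simp
  have hv : NNReal.mk (s ^ 2) (sq_nonneg s) ≠ 0 := by
    intro h
    have := congrArg NNReal.toReal h
    simp [hs.ne'] at this
  rw [← lintegral_map (f := f) (g := fun z => m + s * z) hf (by fun_prop), hmap,
    gaussianReal_of_var_ne_zero _ hv,
    lintegral_withDensity_eq_lintegral_mul _ (measurable_gaussianPDF _ _) hf]
  refine lintegral_congr fun x => ?_
  simp only [Pi.mul_apply, gaussianPDF, gaussianPDFReal, NNReal.coe_mk]
  rw [Real.sqrt_mul (by positivity), Real.sqrt_sq hs.le]

lemma one_sub_sq_pos {ρ : ℝ} (hρ : |ρ| < 1) : 0 < 1 - ρ ^ 2 := by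
  have := (sq_lt_one_iff_abs_lt_one ρ).2 hρ
  linarith

/-- The bivariate normal density as marginal density of the first coordinate times conditional
density of the second coordinate. -/
lemma normalPDF_eq_mul (μ₁ μ₂ : ℝ) {σ₁ σ₂ ρ : ℝ} (h₁ : 0 < σ₁) (h₂ : 0 < σ₂) (hρ : |ρ| < 1)
    (x : ℝ × ℝ) :
    normalPDF μ₁ μ₂ σ₁ σ₂ ρ x =
      (√(2 * Real.pi) * σ₁)⁻¹ * Real.exp (-(x.1 - μ₁) ^ 2 / (2 * σ₁ ^ 2)) *
      ((√(2 * Real.pi) * (σ₂ * √(1 - ρ ^ 2)))⁻¹ *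
        Real.exp (-(x.2 - (μ₂ + ρ * σ₂ / σ₁ * (x.1 - μ₁))) ^ 2 /
          (2 * (σ₂ * √(1 - ρ ^ 2)) ^ 2))) := by
  have h := one_sub_sq_pos hρ
  have hpi : √(2 * Real.pi) * √(2 * Real.pi) = 2 * Real.pi :=
    Real.mul_self_sqrt (by positivity)
  rw [mul_mul_mul_comm, ← Real.exp_add, ← mul_inv, normalPDF, mul_mul_mul_comm, hpi]
  congr 2
  · ring
  · rw [mul_pow, Real.sq_sqrt h.le]
    field_simp
    ring

/-- The density factors into marginal and conditional Gaussian densities, and each is standardized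
by an affine substitution, the inner one with the first coordinate fixed. -/
lemma normalLaw_eq_map (μ₁ μ₂ : ℝ) {σ₁ σ₂ ρ : ℝ} (h₁ : 0 < σ₁) (h₂ : 0 < σ₂) (hρ : |ρ| < 1) :
    normalLaw μ₁ μ₂ σ₁ σ₂ ρ = ((gaussianReal 0 1).prod (gaussianReal 0 1)).map fun z =>
      (μ₁ + σ₁ * z.1, μ₂ + ρ * σ₂ * z.1 + σ₂ * √(1 - ρ ^ 2) * z.2) := by
  have h := one_sub_sq_pos hρ
  refine Measure.ext_of_lintegral _ fun f hf => ?_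
  have hmeas : Measurable (normalPDF μ₁ μ₂ σ₁ σ₂ ρ) := by unfold normalPDF; fun_prop
  rw [lintegral_map hf (by fun_prop), lintegral_prod _ (by fun_prop), normalLaw,
    lintegral_withDensity_eq_lintegral_mul _ (by fun_prop) hf, Measure.volume_eq_prod,
    lintegral_prod _ (by fun_prop)]
  simp only [Pi.mul_apply]
  have e1 : ∀ x : ℝ, ∫⁻ z, f (μ₁ + σ₁ * x, μ₂ + ρ * σ₂ * x + σ₂ * √(1 - ρ ^ 2) * z)
      ∂gaussianReal 0 1 = (fun t => ∫⁻ y, ENNReal.ofReal ((√(2 * Real.pi) *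
        (σ₂ * √(1 - ρ ^ 2)))⁻¹ * Real.exp (-(y - (μ₂ + ρ * σ₂ / σ₁ * (t - μ₁))) ^ 2 /
          (2 * (σ₂ * √(1 - ρ ^ 2)) ^ 2))) * f (t, y)) (μ₁ + σ₁ * x) := by
    intro x
    rw [lintegral_gaussianReal_affine (f := fun y => f (μ₁ + σ₁ * x, y)) _
      (mul_pos h₂ (Real.sqrt_pos.2 h)) (by fun_prop)]
    simp only
    rw [show ρ * σ₂ / σ₁ * (μ₁ + σ₁ * x - μ₁) = ρ * σ₂ * x by field_simp; ring]
  simp_rw [e1]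
  rw [lintegral_gaussianReal_affine _ h₁ (Measurable.lintegral_prod_right' (f := fun z : ℝ × ℝ =>
    ENNReal.ofReal ((√(2 * Real.pi) *
        (σ₂ * √(1 - ρ ^ 2)))⁻¹ * Real.exp (-(z.2 - (μ₂ + ρ * σ₂ / σ₁ * (z.1 - μ₁))) ^ 2 /
          (2 * (σ₂ * √(1 - ρ ^ 2)) ^ 2))) * f (z.1, z.2)) (by fun_prop))]
  refine lintegral_congr fun x => ?_
  rw [← lintegral_const_mul _ (by fun_prop)]
  refine lintegral_congr fun y => ?_
  rw [normalPDF_eq_mul μ₁ μ₂ h₁ h₂ hρ, ENNReal.ofReal_mul (by positivity), mul_assoc]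

lemma sampleLaw_eq_map (n : ℕ) (μ₁ μ₂ : ℝ) {σ₁ σ₂ ρ : ℝ} (h₁ : 0 < σ₁) (h₂ : 0 < σ₂)
    (hρ : |ρ| < 1) :
    sampleLaw n μ₁ μ₂ σ₁ σ₂ ρ = ((stdSample n).prod (stdSample n)).map fun z k =>
      (μ₁ + σ₁ * z.1 k, μ₂ + ρ * σ₂ * z.1 k + σ₂ * √(1 - ρ ^ 2) * z.2 k) := by
  have hg : Measurable fun z : ℝ × ℝ =>
      (μ₁ + σ₁ * z.1, μ₂ + ρ * σ₂ * z.1 + σ₂ * √(1 - ρ ^ 2) * z.2) := by fun_prop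
  have : IsProbabilityMeasure (((gaussianReal 0 1).prod (gaussianReal 0 1)).map fun z : ℝ × ℝ =>
      (μ₁ + σ₁ * z.1, μ₂ + ρ * σ₂ * z.1 + σ₂ * √(1 - ρ ^ 2) * z.2)) :=
    Measure.isProbabilityMeasure_map hg.aemeasurable
  have hA := measurePreserving_arrowProdEquivProdArrow ℝ ℝ (Fin n)
    (fun _ => gaussianReal 0 1) (fun _ => gaussianReal 0 1)
  rw [sampleLaw, normalLaw_eq_map μ₁ μ₂ h₁ h₂ hρ, ← Measure.pi_map_pi fun _ => hg.aemeasurable,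
    stdSample, ← hA.map_eq, Measure.map_map _ hA.measurable]
  · rfl
  · exact measurable_pi_lambda _ fun k => by fun_prop

section Sample

variable {n : ℕ}

/-- The residual sum of squares of the second coordinate given the first one. -/
def rss (X : Fin n → ℝ × ℝ) : ℝ := residualSum (fun k => (X k).1) (fun k => (X k).2)

/-- Identifies the scale in `θ₄*` with the residual sum of squares. -/
lemma s22_mul_one_sub_corr_sq {X : Fin n → ℝ × ℝ} (h₁ : 0 < s11 X) (h₂ : 0 < s22 X) :
    s22 X * (1 - corr X ^ 2) = rss X := by
  rw [corr, div_pow, Real.sq_sqrt (mul_pos h₁ h₂).le]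
  change _ = s22 X - s12 X ^ 2 / s11 X
  field_simp

lemma rss_pos {X : Fin n → ℝ × ℝ} (h₁ : 0 < s11 X) (h₂ : 0 < s22 X) (h : |corr X| < 1) :
    0 < rss X := by
  rw [← s22_mul_one_sub_corr_sq h₁ h₂]
  exact mul_pos h₂ (one_sub_sq_pos h)

lemma measurable_s11 : Measurable (s11 (n := n)) := by
  unfold s11 devSum mean
  fun_prop

lemma measurable_rss : Measurable (rss (n := n)) := by
  unfold rss residualSum devSum mean
  fun_prop

/-- The joint sampling law of the standardized sum of squares of the first coordinate and the
standardized residual sum of squares of the second one. -/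
lemma sampleLaw_map (hn : 3 ≤ n) (μ₁ μ₂ : ℝ) {σ₁ σ₂ ρ : ℝ} (h₁ : 0 < σ₁) (h₂ : 0 < σ₂)
    (hρ : |ρ| < 1) :
    (sampleLaw n μ₁ μ₂ σ₁ σ₂ ρ).map
      (fun X => (s11 X / σ₁ ^ 2, rss X / (σ₂ * √(1 - ρ ^ 2)) ^ 2)) =
      chiSquaredPair (n - 1) (n - 2) := by
  have hτ : 0 < σ₂ * √(1 - ρ ^ 2) := mul_pos h₂ (Real.sqrt_pos.2 (one_sub_sq_pos hρ))
  have hm : Measurable fun X : Fin n → ℝ × ℝ =>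
      (s11 X / σ₁ ^ 2, rss X / (σ₂ * √(1 - ρ ^ 2)) ^ 2) :=
    (measurable_s11.div_const _).prodMk (measurable_rss.div_const _)
  rw [sampleLaw_eq_map n μ₁ μ₂ h₁ h₂ hρ, ← stdSample_prod_map hn, Measure.map_map hm
    (measurable_pi_lambda _ fun k => by fun_prop)]
  refine Measure.map_congr ?_
  have hq := Measure.quasiMeasurePreserving_fst (μ := stdSample n) (ν := stdSample n)
  filter_upwards [hq.ae (ae_stdSample_devSum_ne_zero (by omega : 2 ≤ n))] with z hz
  simp only [Function.comp_apply, s11, rss]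
  rw [devSum_affine_self (by omega), residualSum_affine (by omega) _ _ _ _ h₁.ne' hz,
    mul_div_cancel_left₀ _ (by positivity), mul_div_cancel_left₀ _ (by positivity)]

lemma ae_sampleLaw_pos (hn : 3 ≤ n) (μ₁ μ₂ : ℝ) {σ₁ σ₂ ρ : ℝ} (h₁ : 0 < σ₁) (h₂ : 0 < σ₂)
    (hρ : |ρ| < 1) :
    ∀ᵐ X ∂sampleLaw n μ₁ μ₂ σ₁ σ₂ ρ, 0 < s11 X ∧ 0 < rss X := by
  have hn' : (3 : ℝ) ≤ n := by exact_mod_cast hn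
  have hm : Measurable fun X : Fin n → ℝ × ℝ =>
      (s11 X / σ₁ ^ 2, rss X / (σ₂ * √(1 - ρ ^ 2)) ^ 2) :=
    (measurable_s11.div_const _).prodMk (measurable_rss.div_const _)
  have h := ae_chiSquaredPair_pos (ν₁ := n - 1) (ν₂ := n - 2) (by linarith) (by linarith)
  rw [← sampleLaw_map hn μ₁ μ₂ h₁ h₂ hρ] at h
  filter_upwards [ae_of_ae_map hm.aemeasurable h] with X hX
  refine ⟨?_, ?_⟩
  · have := hX.1
    by_contra! h0
    exact absurd this (not_lt.2 (div_nonpos_of_nonpos_of_nonneg h0 (by positivity)))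
  · have := hX.2
    by_contra! h0
    exact absurd this (not_lt.2 (div_nonpos_of_nonpos_of_nonneg h0 (by positivity)))

end Sample

/-! ### One-dimensional integrals -/

lemma lintegral_exp_neg_sq (m : ℝ) {s : ℝ} (hs : 0 < s) :
    ∫⁻ x, ENNReal.ofReal (Real.exp (-(x - m) ^ 2 / (2 * s ^ 2))) =
      ENNReal.ofReal (√(2 * Real.pi) * s) := by
  have h := lintegral_gaussianReal_affine m hs (f := fun _ => 1) measurable_const
  have hc : 0 < √(2 * Real.pi) * s := mul_pos (Real.sqrt_pos.2 (by positivity)) hs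
  simp only [lintegral_const, measure_univ, mul_one] at h
  simp_rw [ENNReal.ofReal_mul (inv_pos.2 hc).le] at h
  rw [lintegral_const_mul _ (by fun_prop), ENNReal.ofReal_inv_of_pos hc] at h
  rw [← ENNReal.div_eq_one_iff (ENNReal.ofReal_pos.2 hc).ne' ENNReal.ofReal_ne_top,
    ENNReal.div_eq_inv_mul, ← h]

lemma lintegral_Ioi_comp_mul_right {c : ℝ} (hc : 0 < c) (f : ℝ → ENNReal) :
    ∫⁻ x in Ioi 0, f x = ∫⁻ x in Ioi 0, ENNReal.ofReal c * f (x * c) := by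
  have h := lintegral_image_eq_lintegral_abs_deriv_mul (f := fun x => x * c) (f' := fun _ => c)
    (measurableSet_Ioi (a := (0 : ℝ)))
    (fun r _ => (hasDerivAt_mul_const c).hasDerivWithinAt)
    (fun x _ y _ hxy => mul_right_cancel₀ hc.ne' hxy) f
  have himg : (fun x => x * c) '' Ioi 0 = Ioi 0 := by
    ext x
    refine ⟨?_, fun hx => ⟨x / c, div_pos hx hc, div_mul_cancel₀ _ hc.ne'⟩⟩
    rintro ⟨y, hy, rfl⟩
    exact mul_pos hy hc
  rw [himg] at h
  simpa [abs_of_pos hc] using h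

lemma lintegral_comp_mul_right {c : ℝ} (hc : 0 < c) (f : ℝ → ENNReal) :
    ∫⁻ x, f x = ∫⁻ x, ENNReal.ofReal c * f (x * c) := by
  have h := lintegral_image_eq_lintegral_abs_deriv_mul (f := fun x => x * c) (f' := fun _ => c)
    (MeasurableSet.univ (α := ℝ))
    (fun r _ => (hasDerivAt_mul_const c).hasDerivWithinAt)
    (fun x _ y _ hxy => mul_right_cancel₀ hc.ne' hxy) f
  rw [image_univ, (mul_right_surjective₀ hc.ne').range_eq] at h
  simpa [abs_of_pos hc] using h

lemma hasDerivAt_div_sqrt_one_sub_sq {ρ : ℝ} (hρ : |ρ| < 1) :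
    HasDerivAt (fun ρ => ρ / √(1 - ρ ^ 2)) (√(1 - ρ ^ 2) ^ 3)⁻¹ ρ := by
  have h := one_sub_sq_pos hρ
  have hs : 0 < √(1 - ρ ^ 2) := Real.sqrt_pos.2 h
  have h1 : HasDerivAt (fun ρ : ℝ => 1 - ρ ^ 2) (-(2 * ρ)) ρ := by
    simpa using (hasDerivAt_pow 2 ρ).const_sub 1
  refine ((hasDerivAt_id ρ).div (h1.sqrt h.ne') hs.ne').congr_deriv ?_
  have h2 : √(1 - ρ ^ 2) ^ 2 = 1 - ρ ^ 2 := Real.sq_sqrt h.le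
  simp only [id]
  field_simp
  rw [h2]
  ring

/-- The substitution `w = ρ / √(1 - ρ²)` from `(-1, 1)` onto the line; up to the factor `τ / σ₁`,
`w` is the slope `β`. -/
lemma lintegral_Ioo_div_sqrt_one_sub_sq (f : ℝ → ENNReal) :
    ∫⁻ w, f w = ∫⁻ ρ in Ioo (-1) 1, ENNReal.ofReal (√(1 - ρ ^ 2) ^ 3)⁻¹ * f (ρ / √(1 - ρ ^ 2)) := by
  have hinj : InjOn (fun ρ : ℝ => ρ / √(1 - ρ ^ 2)) (Ioo (-1) 1) := by
    intro x hx y hy hxy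
    have hx' := one_sub_sq_pos (abs_lt.2 hx)
    have hy' := one_sub_sq_pos (abs_lt.2 hy)
    have hsx := Real.sqrt_pos.2 hx'
    have hsy := Real.sqrt_pos.2 hy'
    simp only at hxy
    have hsq : (x / √(1 - x ^ 2)) ^ 2 = (y / √(1 - y ^ 2)) ^ 2 := by rw [hxy]
    rw [div_pow, div_pow, Real.sq_sqrt hx'.le, Real.sq_sqrt hy'.le,
      div_eq_div_iff hx'.ne' hy'.ne'] at hsq
    have : x ^ 2 = y ^ 2 := by linarith
    rw [this] at hxy
    field_simp at hxy
    exact hxy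
  have himg : (fun ρ : ℝ => ρ / √(1 - ρ ^ 2)) '' Ioo (-1) 1 = univ := by
    rw [eq_univ_iff_forall]
    intro w
    have hs : 0 < 1 + w ^ 2 := by positivity
    have hs' := Real.sqrt_pos.2 hs
    have e : 1 - (w / √(1 + w ^ 2)) ^ 2 = (√(1 + w ^ 2))⁻¹ ^ 2 := by
      rw [div_pow, inv_pow, Real.sq_sqrt hs.le]
      field_simp
      ring
    -- The inverse of `ρ ↦ ρ / √(1 - ρ²)`.
    refine ⟨w / √(1 + w ^ 2), ?_, ?_⟩
    · rw [mem_Ioo, ← abs_lt, ← sq_lt_one_iff_abs_lt_one]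
      have : 0 < (√(1 + w ^ 2))⁻¹ ^ 2 := by positivity
      linarith
    · simp only
      rw [e, Real.sqrt_sq (by positivity)]
      field_simp
  have h := lintegral_image_eq_lintegral_abs_deriv_mul measurableSet_Ioo
    (fun ρ hρ => (hasDerivAt_div_sqrt_one_sub_sq (abs_lt.2 hρ)).hasDerivWithinAt) hinj f
  rw [himg, Measure.restrict_univ] at h
  rw [h]
  refine setLIntegral_congr_fun measurableSet_Ioo fun ρ hρ => ?_
  have := Real.sqrt_pos.2 (one_sub_sq_pos (abs_lt.2 hρ))
  rw [abs_of_pos (by positivity)]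

/-- Change of variables from `(σ₂, ρ)` to `(β, τ) = (ρ σ₂ / σ₁, σ₂ √(1 - ρ²))`. -/
lemma lintegral_regression_param {σ₁ : ℝ} (h₁ : 0 < σ₁) {F : ℝ × ℝ → ENNReal}
    (hF : Measurable F) :
    ∫⁻ σ₂ in Ioi 0, ∫⁻ ρ in Ioo (-1) 1, ENNReal.ofReal (σ₂ / (σ₁ * √(1 - ρ ^ 2))) *
      F (ρ * σ₂ / σ₁, σ₂ * √(1 - ρ ^ 2)) = ∫⁻ τ in Ioi 0, ∫⁻ β, F (β, τ) := by
  -- The substitution splits into one-dimensional ones: `τ = σ₂ √(1 - ρ²)` at fixed `ρ`, then, after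
  -- swapping back, `β = (ρ / √(1 - ρ²)) (τ / σ₁)` at fixed `τ`.
  rw [lintegral_lintegral_swap (Measurable.aemeasurable (by fun_prop))]
  have e1 : ∀ ρ ∈ Ioo (-1 : ℝ) 1,
      ∫⁻ σ₂ in Ioi 0, ENNReal.ofReal (σ₂ / (σ₁ * √(1 - ρ ^ 2))) *
        F (ρ * σ₂ / σ₁, σ₂ * √(1 - ρ ^ 2)) =
      ∫⁻ τ in Ioi 0, ENNReal.ofReal (√(1 - ρ ^ 2) ^ 3)⁻¹ * (ENNReal.ofReal (τ / σ₁) *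
        F (ρ / √(1 - ρ ^ 2) * (τ / σ₁), τ)) := by
    intro ρ hρ
    have hc := Real.sqrt_pos.2 (one_sub_sq_pos (abs_lt.2 hρ))
    rw [lintegral_Ioi_comp_mul_right hc fun τ => ENNReal.ofReal (√(1 - ρ ^ 2) ^ 3)⁻¹ *
      (ENNReal.ofReal (τ / σ₁) * F (ρ / √(1 - ρ ^ 2) * (τ / σ₁), τ))]
    refine setLIntegral_congr_fun measurableSet_Ioi fun σ₂ hσ => ?_
    have hσ : 0 < σ₂ := hσ
    rw [← mul_assoc, ← mul_assoc, ← ENNReal.ofReal_mul hc.le, ← ENNReal.ofReal_mul (by positivity)]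
    congr 2
    · field_simp
    · congr 2
      field_simp
  rw [setLIntegral_congr_fun measurableSet_Ioo e1,
    lintegral_lintegral_swap (Measurable.aemeasurable (by fun_prop))]
  refine setLIntegral_congr_fun measurableSet_Ioi fun τ hτ => ?_
  have hτ : 0 < τ := hτ
  rw [lintegral_comp_mul_right (div_pos hτ h₁) (fun β => F (β, τ)),
    lintegral_Ioo_div_sqrt_one_sub_sq]

/-! ### The likelihood and the prior in the regression parametrization -/

lemma sum_sub_sq {n : ℕ} (x : Fin n → ℝ) (m : ℝ) :
    ∑ k, (x k - m) ^ 2 = n * (m - mean x) ^ 2 + devSum x x := by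
  have h : ∀ k, (x k - m) ^ 2 =
      (m - mean x) ^ 2 + 2 * (mean x - m) * (x k - mean x) + (x k - mean x) * (x k - mean x) :=
    fun k => by ring
  simp only [h, Finset.sum_add_distrib, ← Finset.mul_sum, sum_sub_mean, devSum]
  simp

/-- Completing squares in the conditional model of `y` given `x`. The centre of the `μ₂` factor
involves `μ₁` and `β`, and no other factor involves `μ₂`, so integrating in the order `μ₂`, `μ₁`,
`β` meets a Gaussian at each stage. -/
lemma likelihood_eq {n : ℕ} (hn : n ≠ 0) (X : Fin n → ℝ × ℝ) (hX : s11 X ≠ 0) (μ₁ μ₂ : ℝ)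
    {σ₁ σ₂ ρ : ℝ} (h₁ : 0 < σ₁) (h₂ : 0 < σ₂) (hρ : |ρ| < 1) :
    likelihood X (μ₁, μ₂, σ₁, σ₂, ρ) =
      ((√(2 * Real.pi) * σ₁)⁻¹ * (√(2 * Real.pi) * (σ₂ * √(1 - ρ ^ 2)))⁻¹) ^ n *
      Real.exp (-s11 X / (2 * σ₁ ^ 2)) * Real.exp (-rss X / (2 * (σ₂ * √(1 - ρ ^ 2)) ^ 2)) *
      Real.exp (-(ρ * σ₂ / σ₁ - s12 X / s11 X) ^ 2 /
        (2 * (σ₂ * √(1 - ρ ^ 2) / √(s11 X)) ^ 2)) *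
      (Real.exp (-(μ₁ - mean fun k => (X k).1) ^ 2 / (2 * (σ₁ / √n) ^ 2)) *
      Real.exp (-(μ₂ - ((mean fun k => (X k).2) +
        ρ * σ₂ / σ₁ * (μ₁ - mean fun k => (X k).1))) ^ 2 /
        (2 * (σ₂ * √(1 - ρ ^ 2) / √n) ^ 2))) := by
  set x : Fin n → ℝ := fun k => (X k).1 with hx
  set y : Fin n → ℝ := fun k => (X k).2 with hy
  have hτ : 0 < σ₂ * √(1 - ρ ^ 2) := mul_pos h₂ (Real.sqrt_pos.2 (one_sub_sq_pos hρ))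
  set τ := σ₂ * √(1 - ρ ^ 2) with hτ'
  set β := ρ * σ₂ / σ₁ with hβ
  have hn' : (0 : ℝ) < n := by positivity
  have hX0 : 0 < s11 X := lt_of_le_of_ne (devSum_self_nonneg _) hX.symm
  have e2 : ∑ k, ((X k).2 - (μ₂ + β * ((X k).1 - μ₁))) ^ 2 =
      n * (μ₂ - (mean y + β * (μ₁ - mean x))) ^ 2 + rss X +
        s11 X * (β - s12 X / s11 X) ^ 2 := by
    -- The residual of an observation is the deviation of `y - β x` from `μ₂ - β μ₁`.
    have h := sum_sub_sq (fun k => 0 + 1 * y k + (-β) * x k) (μ₂ - β * μ₁)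
    rw [mean_affine hn, devSum_affine_left hn, devSum_affine_right hn, devSum_affine_right hn,
      devSum_comm y x] at h
    rw [show ∑ k, ((X k).2 - (μ₂ + β * ((X k).1 - μ₁))) ^ 2 =
      ∑ k, (0 + 1 * y k + -β * x k - (μ₂ - β * μ₁)) ^ 2 from
        Finset.sum_congr rfl fun k _ => by simp only [hx, hy]; ring, h]
    have r : rss X = devSum y y - s12 X ^ 2 / s11 X := rfl
    have r1 : devSum x x = s11 X := rfl
    have r2 : devSum x y = s12 X := rfl
    rw [r, r1, r2]
    field_simp
    ring
  simp only [likelihood, normalPDF_eq_mul μ₁ μ₂ h₁ h₂ hρ, ← hτ', ← hβ]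
  rw [Finset.prod_mul_distrib, Finset.prod_mul_distrib, Finset.prod_mul_distrib,
    ← Real.exp_sum, ← Real.exp_sum, ← Finset.sum_div, ← Finset.sum_div,
    Finset.sum_neg_distrib, Finset.sum_neg_distrib, e2, sum_sub_sq x]
  simp only [Finset.prod_const, Finset.card_univ, Fintype.card_fin]
  rw [mul_mul_mul_comm, ← mul_pow, ← Real.exp_add, ← Real.exp_add, mul_assoc (_ ^ n),
    mul_assoc (_ ^ n), mul_assoc (_ ^ n), ← Real.exp_add, ← Real.exp_add, ← Real.exp_add]
  congr 2
  rw [div_pow, div_pow, div_pow, Real.sq_sqrt hn'.le, Real.sq_sqrt hX0.le]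
  change -(_ + s11 X) / _ + _ = _
  field_simp
  ring

/-- The first factor is the absolute Jacobian of `(σ₂, ρ) ↦ (β, τ)`; the rest is the prior in the
parameters `(σ₁, β, τ)`, flat in `β`. -/
lemma priorDensity_eq (a b μ₁ μ₂ : ℝ) {σ₁ σ₂ ρ : ℝ} (h₁ : 0 < σ₁) (h₂ : 0 < σ₂) (hρ : |ρ| < 1) :
    priorDensity a b (μ₁, μ₂, σ₁, σ₂, ρ) =
      σ₂ / (σ₁ * √(1 - ρ ^ 2)) * (σ₁ ^ (a - 2) * (σ₂ * √(1 - ρ ^ 2)) ^ (b - 3)) := by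
  have h := one_sub_sq_pos hρ
  have hc := Real.sqrt_pos.2 h
  simp only [priorDensity]
  set c := √(1 - ρ ^ 2) with hc'
  have e : 1 - ρ ^ 2 = c ^ (2 : ℝ) := by rw [hc']; norm_cast; rw [Real.sq_sqrt h.le]
  rw [e, ← Real.rpow_mul hc.le, Real.mul_rpow h₂.le hc.le,
    show a - 2 = -(3 - a) + 1 by ring, show 2 * (2 - b / 2) = -(b - 3 - 1) by ring,
    show 2 - b = -(b - 3 + 1) by ring, Real.rpow_add_one h₁.ne', Real.rpow_neg h₁.le,
    Real.rpow_neg h₂.le, Real.rpow_neg hc.le, Real.rpow_add_one h₂.ne', Real.rpow_sub_one hc.ne']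
  have := Real.rpow_pos_of_pos h₁ (3 - a)
  field_simp

/-! ### The posterior law -/

lemma paramSpace_eq_prod :
    paramSpace = univ ×ˢ univ ×ˢ Ioi (0 : ℝ) ×ˢ Ioi (0 : ℝ) ×ˢ Ioo (-1 : ℝ) 1 := by
  ext p
  simp [paramSpace, abs_lt]

lemma measurableSet_paramSpace : MeasurableSet paramSpace := by
  rw [paramSpace_eq_prod]
  measurability

lemma setLIntegral_paramSpace {f : Param → ENNReal} (hf : Measurable f) :
    ∫⁻ p in paramSpace, f p = ∫⁻ σ₁ in Ioi 0, ∫⁻ σ₂ in Ioi 0, ∫⁻ ρ in Ioo (-1) 1,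
      ∫⁻ μ₁, ∫⁻ μ₂, f (μ₁, μ₂, σ₁, σ₂, ρ) := by
  rw [paramSpace_eq_prod]
  simp only [Measure.volume_eq_prod]
  rw [← Measure.prod_restrict, ← Measure.prod_restrict, ← Measure.prod_restrict,
    ← Measure.prod_restrict, Measure.restrict_univ, lintegral_prod_symm' _ hf,
    lintegral_prod_symm' _ (by fun_prop)]
  have e : ∀ s : ℝ × ℝ × ℝ, ∫⁻ μ₂, ∫⁻ μ₁, f (μ₁, μ₂, s) = ∫⁻ μ₁, ∫⁻ μ₂, f (μ₁, μ₂, s) :=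
    fun s => lintegral_lintegral_swap (Measurable.aemeasurable (by fun_prop))
  simp_rw [e]
  rw [lintegral_prod _ (Measurable.aemeasurable (by fun_prop))]
  refine lintegral_congr fun σ₁ => ?_
  rw [lintegral_prod _ (Measurable.aemeasurable (by fun_prop))]

lemma measurable_normalPDF {n : ℕ} (X : Fin n → ℝ × ℝ) (k : Fin n) :
    Measurable fun p : Param => normalPDF p.1 p.2.1 p.2.2.1 p.2.2.2.1 p.2.2.2.2 (X k) := by
  unfold normalPDF
  fun_prop

lemma measurable_likelihood {n : ℕ} (X : Fin n → ℝ × ℝ) : Measurable (likelihood X) :=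
  Finset.measurable_fun_prod _ fun k _ => measurable_normalPDF X k

lemma measurable_priorDensity (a b : ℝ) : Measurable (priorDensity a b) := by
  unfold priorDensity
  fun_prop

/-- The unnormalized posterior density of `(σ₁, β, τ)`, with `β = ρ σ₂ / σ₁` and
`τ = σ₂ √(1 - ρ²)`. -/
def regressionDensity (a b : ℝ) {n : ℕ} (X : Fin n → ℝ × ℝ) (σ₁ β τ : ℝ) : ℝ :=
  σ₁ ^ (a - 2) * τ ^ (b - 3) * ((√(2 * Real.pi) * σ₁)⁻¹ * (√(2 * Real.pi) * τ)⁻¹) ^ n *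
    Real.exp (-s11 X / (2 * σ₁ ^ 2)) * Real.exp (-rss X / (2 * τ ^ 2)) *
    (√(2 * Real.pi) * (σ₁ / √n)) * (√(2 * Real.pi) * (τ / √n)) *
    Real.exp (-(β - s12 X / s11 X) ^ 2 / (2 * (τ / √(s11 X)) ^ 2))

lemma lintegral_priorDensity_mul_likelihood (a b : ℝ) {n : ℕ} (hn : n ≠ 0) (X : Fin n → ℝ × ℝ)
    (hX : s11 X ≠ 0) {σ₁ σ₂ ρ : ℝ} (h₁ : 0 < σ₁) (h₂ : 0 < σ₂) (hρ : |ρ| < 1) :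
    ∫⁻ μ₁, ∫⁻ μ₂, ENNReal.ofReal (priorDensity a b (μ₁, μ₂, σ₁, σ₂, ρ) *
      likelihood X (μ₁, μ₂, σ₁, σ₂, ρ)) =
      ENNReal.ofReal (σ₂ / (σ₁ * √(1 - ρ ^ 2))) *
        ENNReal.ofReal (regressionDensity a b X σ₁ (ρ * σ₂ / σ₁) (σ₂ * √(1 - ρ ^ 2))) := by
  have hc : 0 < √(1 - ρ ^ 2) := Real.sqrt_pos.2 (one_sub_sq_pos hρ)
  have hτ : 0 < σ₂ * √(1 - ρ ^ 2) := mul_pos h₂ hc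
  have hn' : (0 : ℝ) < √n := Real.sqrt_pos.2 (by positivity)
  simp only [priorDensity_eq a b _ _ h₁ h₂ hρ, likelihood_eq hn X hX _ _ h₁ h₂ hρ,
    regressionDensity]
  set τ := σ₂ * √(1 - ρ ^ 2) with hτ'
  set β := ρ * σ₂ / σ₁ with hβ
  set J := σ₂ / (σ₁ * √(1 - ρ ^ 2)) with hJ
  have hJ0 : 0 < J := by positivity
  set A := ((√(2 * Real.pi) * σ₁)⁻¹ * (√(2 * Real.pi) * τ)⁻¹) ^ n with hA
  set E1 := Real.exp (-s11 X / (2 * σ₁ ^ 2))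
  set E2 := Real.exp (-rss X / (2 * τ ^ 2))
  set E3 := Real.exp (-(β - s12 X / s11 X) ^ 2 / (2 * (τ / √(s11 X)) ^ 2))
  set P := σ₁ ^ (a - 2) * τ ^ (b - 3) with hP
  have hP0 : 0 < P := mul_pos (Real.rpow_pos_of_pos h₁ _) (Real.rpow_pos_of_pos hτ _)
  have hA0 : 0 < A := by positivity
  have hM : 0 ≤ J * P * (A * E1 * E2 * E3) := by positivity
  have hsplit : ∀ g : ℝ, ENNReal.ofReal (J * P * (A * E1 * E2 * E3 * g)) =
      ENNReal.ofReal (J * P * (A * E1 * E2 * E3)) * ENNReal.ofReal g := fun g => by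
    rw [← mul_assoc, ENNReal.ofReal_mul hM]
  simp_rw [hsplit]
  simp_rw [ENNReal.ofReal_mul (Real.exp_pos _).le]
  have e : ∀ μ₁ : ℝ, ∫⁻ μ₂, ENNReal.ofReal (J * P * (A * E1 * E2 * E3)) *
      (ENNReal.ofReal (Real.exp (-(μ₁ - mean fun k => (X k).1) ^ 2 / (2 * (σ₁ / √n) ^ 2))) *
      ENNReal.ofReal (Real.exp (-(μ₂ - ((mean fun k => (X k).2) +
        β * (μ₁ - mean fun k => (X k).1))) ^ 2 / (2 * (τ / √n) ^ 2)))) =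
      ENNReal.ofReal (J * P * (A * E1 * E2 * E3)) * ENNReal.ofReal (√(2 * Real.pi) * (τ / √n)) *
      ENNReal.ofReal (Real.exp (-(μ₁ - mean fun k => (X k).1) ^ 2 / (2 * (σ₁ / √n) ^ 2))) := by
    intro μ₁
    rw [lintegral_const_mul _ (by fun_prop), lintegral_const_mul _ (by fun_prop),
      lintegral_exp_neg_sq _ (div_pos hτ hn')]
    ring
  simp_rw [e]
  rw [lintegral_const_mul _ (by fun_prop), lintegral_exp_neg_sq _ (div_pos h₁ hn'),
    ← ENNReal.ofReal_mul hM, ← ENNReal.ofReal_mul (by positivity), ← ENNReal.ofReal_mul hJ0.le]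
  congr 1
  ring

/-- The `β` integral contributes a factor `τ`, after which `σ₁` and `τ` separate. The exponents are
written to fit `exists_lintegral_rpow_mul_exp_eq` with `p = -2`. -/
lemma lintegral_regressionDensity (a b : ℝ) {n : ℕ} (hn : n ≠ 0) (X : Fin n → ℝ × ℝ)
    (hX : 0 < s11 X) {σ₁ τ : ℝ} (h₁ : 0 < σ₁) (hτ : 0 < τ) :
    ∫⁻ β, ENNReal.ofReal (regressionDensity a b X σ₁ β τ) =
      ENNReal.ofReal ((√(2 * Real.pi) ^ (2 * n))⁻¹ * √(2 * Real.pi) ^ 3 / (n * √(s11 X))) *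
      (ENNReal.ofReal (σ₁ ^ (-2 * ((n : ℝ) - a) / 2 - 1) *
        Real.exp (-(s11 X * σ₁ ^ (-2 : ℝ)) / 2)) *
      ENNReal.ofReal (τ ^ (-2 * ((n : ℝ) - b) / 2 - 1) *
        Real.exp (-(rss X * τ ^ (-2 : ℝ)) / 2))) := by
  have hn0 : (0 : ℝ) < n := by positivity
  have hn' : (0 : ℝ) < √n := Real.sqrt_pos.2 hn0
  have hs := Real.sqrt_pos.2 hX
  have hpi : 0 < √(2 * Real.pi) := Real.sqrt_pos.2 (by positivity)
  have hp1 := Real.rpow_pos_of_pos h₁ (a - 2)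
  have hp2 := Real.rpow_pos_of_pos hτ (b - 3)
  simp only [regressionDensity]
  simp_rw [ENNReal.ofReal_mul' (Real.exp_pos (-(_ - s12 X / s11 X) ^ 2 / _)).le]
  rw [lintegral_const_mul _ (by fun_prop), lintegral_exp_neg_sq _ (div_pos hτ hs),
    ← ENNReal.ofReal_mul (by positivity), ← ENNReal.ofReal_mul (by positivity),
    ← ENNReal.ofReal_mul (by positivity)]
  congr 1
  have e1 : σ₁ ^ (-2 * ((n : ℝ) - a) / 2 - 1) = σ₁ ^ (a - 2) * σ₁ / σ₁ ^ n := by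
    rw [show -2 * ((n : ℝ) - a) / 2 - 1 = a - 2 + 1 - n by ring, Real.rpow_sub h₁,
      Real.rpow_add_one h₁.ne', Real.rpow_natCast]
  have e2 : τ ^ (-2 * ((n : ℝ) - b) / 2 - 1) = τ ^ (b - 3) * τ ^ 2 / τ ^ n := by
    rw [show -2 * ((n : ℝ) - b) / 2 - 1 = b - 3 + (2 : ℕ) - n by push_cast; ring, Real.rpow_sub hτ,
      Real.rpow_add hτ, Real.rpow_natCast, Real.rpow_natCast]
  have e3 : -(s11 X * σ₁ ^ (-2 : ℝ)) / 2 = -s11 X / (2 * σ₁ ^ 2) := by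
    rw [Real.rpow_neg h₁.le, Real.rpow_ofNat]
    field_simp
  have e4 : -(rss X * τ ^ (-2 : ℝ)) / 2 = -rss X / (2 * τ ^ 2) := by
    rw [Real.rpow_neg hτ.le, Real.rpow_ofNat]
    field_simp
  rw [e1, e2, e3, e4]
  rw [show (n : ℝ) * √(s11 X) = √n * √n * √(s11 X) by rw [Real.mul_self_sqrt hn0.le]]
  generalize √(2 * Real.pi) = c at *
  rw [mul_pow, inv_pow, inv_pow, mul_pow, mul_pow, pow_mul', sq (c ^ n)]
  field_simp

/-- Under the unnormalized posterior, `s₁₁ / σ₁²` and `s₂₂ (1 - r²) / (σ₂² (1 - ρ²))` are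
independent chi-squared variables, up to normalization. -/
lemma exists_lintegral_jointMeasure_eq {a b : ℝ} {n : ℕ} (ha : a < n) (hb : b < n) (hn : n ≠ 0)
    {X : Fin n → ℝ × ℝ} (hX : 0 < s11 X) (hr : 0 < rss X) :
    ∃ C : ENNReal, C ≠ 0 ∧ C ≠ ⊤ ∧ ∀ H : ℝ × ℝ → ENNReal, Measurable H →
      ∫⁻ p, H (s11 X / p.2.2.1 ^ 2, rss X / (p.2.2.2.1 * √(1 - p.2.2.2.2 ^ 2)) ^ 2)
        ∂jointMeasure a b X = C * ∫⁻ u, H u ∂chiSquaredPair (n - a) (n - b) := by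
  have hn0 : (0 : ℝ) < n := by positivity
  have hs := Real.sqrt_pos.2 hX
  have hpi : 0 < √(2 * Real.pi) := Real.sqrt_pos.2 (by positivity)
  obtain ⟨C₁, h10, h1t, hC₁⟩ := exists_lintegral_rpow_mul_exp_eq (sub_pos.2 ha) hX
    (show (-2 : ℝ) ≠ 0 by norm_num)
  obtain ⟨C₂, h20, h2t, hC₂⟩ := exists_lintegral_rpow_mul_exp_eq (sub_pos.2 hb) hr
    (show (-2 : ℝ) ≠ 0 by norm_num)
  set K := (√(2 * Real.pi) ^ (2 * n))⁻¹ * √(2 * Real.pi) ^ 3 / (n * √(s11 X)) with hK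
  have hK0 : 0 < K := by positivity
  have := isProbabilityMeasure_chiSquared (sub_pos.2 ha)
  have := isProbabilityMeasure_chiSquared (sub_pos.2 hb)
  refine ⟨ENNReal.ofReal K * C₂ * C₁, ?_, ?_, fun H hH => ?_⟩
  · exact mul_ne_zero (mul_ne_zero (ENNReal.ofReal_pos.2 hK0).ne' h20) h10
  · exact ENNReal.mul_ne_top (ENNReal.mul_ne_top ENNReal.ofReal_ne_top h2t) h1t
  have hmd : Measurable fun p => priorDensity a b p * likelihood X p :=
    (measurable_priorDensity a b).mul (measurable_likelihood X)
  rw [jointMeasure, lintegral_withDensity_eq_lintegral_mul _ hmd.ennreal_ofReal (by fun_prop),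
    setLIntegral_paramSpace (hmd.ennreal_ofReal.mul (by fun_prop))]
  simp only [Pi.mul_apply]
  have hsq : ∀ {s x : ℝ}, 0 < x → s / x ^ 2 = s * x ^ (-2 : ℝ) := by
    intro s x hx
    rw [Real.rpow_neg hx.le, Real.rpow_ofNat, div_eq_mul_inv]
  have e1 : ∀ σ₁ ∈ Ioi (0 : ℝ), ∫⁻ σ₂ in Ioi 0, ∫⁻ ρ in Ioo (-1) 1, ∫⁻ μ₁, ∫⁻ μ₂,
      ENNReal.ofReal (priorDensity a b (μ₁, μ₂, σ₁, σ₂, ρ) * likelihood X (μ₁, μ₂, σ₁, σ₂, ρ)) *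
        H (s11 X / σ₁ ^ 2, rss X / (σ₂ * √(1 - ρ ^ 2)) ^ 2) =
      ENNReal.ofReal K * C₂ * (ENNReal.ofReal (σ₁ ^ (-2 * ((n : ℝ) - a) / 2 - 1) *
        Real.exp (-(s11 X * σ₁ ^ (-2 : ℝ)) / 2)) *
        ∫⁻ u, H (s11 X * σ₁ ^ (-2 : ℝ), u) ∂chiSquared (n - b)) := by
    intro σ₁ h₁
    have h₁ : 0 < σ₁ := h₁
    have hFm : Measurable fun z : ℝ × ℝ => ENNReal.ofReal (regressionDensity a b X σ₁ z.1 z.2) *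
        H (s11 X / σ₁ ^ 2, rss X / z.2 ^ 2) := by
      unfold regressionDensity
      fun_prop
    have h := lintegral_regression_param h₁ hFm
    calc
      _ = ∫⁻ σ₂ in Ioi 0, ∫⁻ ρ in Ioo (-1) 1, ENNReal.ofReal (σ₂ / (σ₁ * √(1 - ρ ^ 2))) *
          (ENNReal.ofReal (regressionDensity a b X σ₁ (ρ * σ₂ / σ₁) (σ₂ * √(1 - ρ ^ 2))) *
          H (s11 X / σ₁ ^ 2, rss X / (σ₂ * √(1 - ρ ^ 2)) ^ 2)) := by
        refine setLIntegral_congr_fun measurableSet_Ioi fun σ₂ h₂ => ?_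
        refine setLIntegral_congr_fun measurableSet_Ioo fun ρ hρ => ?_
        have hm1 : ∀ μ₁, Measurable fun μ₂ => ENNReal.ofReal
            (priorDensity a b (μ₁, μ₂, σ₁, σ₂, ρ) * likelihood X (μ₁, μ₂, σ₁, σ₂, ρ)) :=
          fun μ₁ => hmd.ennreal_ofReal.comp (g := fun p => ENNReal.ofReal _) (by fun_prop)
        have hm2 : Measurable fun μ₁ => ∫⁻ μ₂, ENNReal.ofReal
            (priorDensity a b (μ₁, μ₂, σ₁, σ₂, ρ) * likelihood X (μ₁, μ₂, σ₁, σ₂, ρ)) :=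
          Measurable.lintegral_prod_right' (f := fun z : ℝ × ℝ => ENNReal.ofReal
            (priorDensity a b (z.1, z.2, σ₁, σ₂, ρ) * likelihood X (z.1, z.2, σ₁, σ₂, ρ)))
            (hmd.ennreal_ofReal.comp (by fun_prop :
              Measurable fun z : ℝ × ℝ => ((z.1, z.2, σ₁, σ₂, ρ) : Param)))
        simp_rw [lintegral_mul_const _ (hm1 _)]
        rw [lintegral_mul_const _ hm2, lintegral_priorDensity_mul_likelihood a b hn X hX.ne' h₁ h₂
          (abs_lt.2 hρ), mul_assoc]
      _ = ∫⁻ τ in Ioi 0, ∫⁻ β, ENNReal.ofReal (regressionDensity a b X σ₁ β τ) *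
          H (s11 X / σ₁ ^ 2, rss X / τ ^ 2) := h
      _ = ∫⁻ τ in Ioi 0, ENNReal.ofReal K * ENNReal.ofReal (σ₁ ^ (-2 * ((n : ℝ) - a) / 2 - 1) *
          Real.exp (-(s11 X * σ₁ ^ (-2 : ℝ)) / 2)) *
          (ENNReal.ofReal (τ ^ (-2 * ((n : ℝ) - b) / 2 - 1) *
          Real.exp (-(rss X * τ ^ (-2 : ℝ)) / 2)) *
          H (s11 X * σ₁ ^ (-2 : ℝ), rss X * τ ^ (-2 : ℝ))) := by
        refine setLIntegral_congr_fun measurableSet_Ioi fun τ hτ => ?_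
        have hτ : 0 < τ := hτ
        have hm : Measurable fun β => ENNReal.ofReal (regressionDensity a b X σ₁ β τ) := by
          unfold regressionDensity
          fun_prop
        rw [lintegral_mul_const _ hm, lintegral_regressionDensity a b hn X hX h₁ hτ, hsq h₁, hsq hτ]
        ring
      _ = _ := by
        rw [lintegral_const_mul _ (by fun_prop), hC₂ (fun u => H (s11 X * σ₁ ^ (-2 : ℝ), u))
          (by fun_prop)]
        ring
  rw [setLIntegral_congr_fun measurableSet_Ioi e1, lintegral_const_mul _ (by fun_prop),
    hC₁ (fun v => ∫⁻ u, H (v, u) ∂chiSquared (n - b)) (by fun_prop), chiSquaredPair,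
    lintegral_prod _ hH.aemeasurable, ← mul_assoc]

/-! ### Quantiles -/

section Quantile

open Filter Topology

variable {m : Measure ℝ} [IsProbabilityMeasure m] {q : ℝ}

/-- Right continuity of the distribution function puts the infimum in the set; `0 < q < 1` makes the
set bounded below and nonempty. -/
lemma quantile_le_iff (hq : q ∈ Ioo (0 : ℝ) 1) (x : ℝ) :
    quantile m q ≤ x ↔ q ≤ m.real (Iic x) := by
  simp only [quantile, ← cdf_eq_real]
  set S : Set ℝ := {x | q ≤ cdf m x} with hS
  have hne : S.Nonempty := ((tendsto_cdf_atTop m).eventually_const_le hq.2).exists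
  have hbdd : BddBelow S := by
    obtain ⟨y, hy⟩ := ((tendsto_cdf_atBot m).eventually_lt_const hq.1).exists
    refine ⟨y, fun z hz => ?_⟩
    by_contra! h
    exact absurd (hz.trans (monotone_cdf m h.le)) (not_le.2 hy)
  refine ⟨fun h => ?_, fun h => csInf_le hbdd h⟩
  refine le_trans ?_ (monotone_cdf m h)
  have hlim : Tendsto (cdf m) (𝓝[>] (sInf S)) (𝓝 (cdf m (sInf S))) :=
    ((cdf m).right_continuous _).mono_left (nhdsWithin_mono _ Ioi_subset_Ici_self)
  refine ge_of_tendsto hlim ?_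
  filter_upwards [self_mem_nhdsWithin] with y hy
  obtain ⟨z, hz, hzy⟩ := (csInf_lt_iff hbdd hne).1 hy
  exact le_trans hz (monotone_cdf m hzy.le)

/-- Every point below the quantile has distribution function less than `q`, which bounds the mass
from above by exhaustion. The lower bound uses that the quantile itself has no mass. -/
lemma measure_Iio_quantile [NullSingletonClass m] (hq : q ∈ Ioo (0 : ℝ) 1) :
    m (Iio (quantile m q)) = ENNReal.ofReal q := by
  refine le_antisymm ?_ ?_
  · have hU : Iio (quantile m q) = ⋃ k : ℕ, Iic (quantile m q - 1 / (k + 1)) := by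
      ext x
      simp only [mem_Iio, mem_iUnion, mem_Iic]
      constructor
      · intro h
        obtain ⟨k, hk⟩ := exists_nat_one_div_lt (sub_pos.2 h)
        exact ⟨k, by linarith⟩
      · rintro ⟨k, hk⟩
        have : (0 : ℝ) < 1 / (k + 1) := by positivity
        linarith
    have hmono : Monotone fun k : ℕ => Iic (quantile m q - 1 / ((k : ℝ) + 1)) := by
      intro i j hij
      refine Iic_subset_Iic.2 ?_
      have := Nat.one_div_le_one_div (α := ℝ) hij
      linarith
    rw [hU, hmono.measure_iUnion]
    refine iSup_le fun k => ?_
    rw [← ofReal_measureReal]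
    refine ENNReal.ofReal_le_ofReal (le_of_lt ?_)
    rw [← not_le, ← quantile_le_iff hq]
    have : (0 : ℝ) < 1 / (k + 1) := by positivity
    linarith
  · rw [measure_congr Iio_ae_eq_Iic, ← ofReal_measureReal]
    exact ENNReal.ofReal_le_ofReal ((quantile_le_iff hq _).1 le_rfl)

/-- A law without atoms that gives the correct mass below every quantile of `m` is `m`. -/
lemma eq_of_measure_Iio_quantile {m' : Measure ℝ} [IsProbabilityMeasure m'] [NullSingletonClass m']
    (h : ∀ q ∈ Ioo (0 : ℝ) 1, m' (Iio (quantile m q)) = ENNReal.ofReal q) : m' = m := by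
  refine Measure.eq_of_cdf _ _ (StieltjesFunction.ext fun x => ?_)
  have hIic : ∀ q ∈ Ioo (0 : ℝ) 1, cdf m' (quantile m q) = q := fun q hq => by
    rw [cdf_eq_real, measureReal_def, ← measure_congr Iio_ae_eq_Iic, h q hq,
      ENNReal.toReal_ofReal hq.1.le]
  -- Any level `q` strictly between `cdf m x` and `c` has its `m`-quantile on a known side of `x`,
  -- and there `cdf m'` equals `q`.
  refine le_antisymm (le_of_forall_gt fun c hc => ?_) (le_of_forall_lt fun c hc => ?_)
  · rcases lt_or_ge 1 c with h1 | h1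
    · exact (cdf_le_one m' x).trans_lt h1
    obtain ⟨q, hcq, hqc⟩ := exists_between hc
    have hq : q ∈ Ioo (0 : ℝ) 1 := ⟨(cdf_nonneg m x).trans_lt hcq, hqc.trans_le h1⟩
    have hx : x ≤ quantile m q := by
      refine le_of_lt (not_le.1 fun hle => ?_)
      rw [quantile_le_iff hq, ← cdf_eq_real] at hle
      exact absurd hcq (not_lt.2 hle)
    exact ((monotone_cdf m' hx).trans_eq (hIic q hq)).trans_lt hqc
  · rcases lt_or_ge c 0 with h0 | h0
    · exact h0.trans_le (cdf_nonneg m' x)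
    obtain ⟨q, hcq, hqc⟩ := exists_between hc
    have hq : q ∈ Ioo (0 : ℝ) 1 := ⟨h0.trans_lt hcq, hqc.trans_le (cdf_le_one m x)⟩
    have hx : quantile m q ≤ x := by
      rw [quantile_le_iff hq, ← cdf_eq_real]
      exact hqc.le
    exact hcq.trans_le ((hIic q hq).symm.trans_le (monotone_cdf m' hx))

lemma quantile_map_sqrt_mul {c : ℝ} (hc : 0 < c) (hq : q ∈ Ioo (0 : ℝ) 1) :
    quantile (m.map fun t => √t * c) q = √(quantile m q) * c := by
  have hmeas : Measurable fun t : ℝ => √t * c := by fun_prop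
  have := Measure.isProbabilityMeasure_map (μ := m) hmeas.aemeasurable
  refine eq_of_forall_ge_iff fun x => ?_
  rw [quantile_le_iff hq, map_measureReal_apply hmeas measurableSet_Iic]
  rcases lt_or_ge x 0 with hx | hx
  · have : (fun t : ℝ => √t * c) ⁻¹' Iic x = ∅ := by
      ext t
      simp only [mem_preimage, mem_Iic, mem_empty_iff_false, iff_false, not_le]
      exact hx.trans_le (by positivity)
    rw [this, measureReal_empty]
    exact iff_of_false (not_le.2 hq.1) (not_le.2 (hx.trans_le (by positivity)))
  -- Since `√t = 0` for negative `t`, the equivalence holds for every real `t`.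
  · have hiff : ∀ t : ℝ, √t * c ≤ x ↔ t ≤ (x / c) ^ 2 := fun t => by
      rw [← le_div_iff₀ hc, Real.sqrt_le_left (div_nonneg hx hc.le)]
    have : (fun t : ℝ => √t * c) ⁻¹' Iic x = Iic ((x / c) ^ 2) := by
      ext t
      exact hiff t
    rw [this, ← quantile_le_iff hq, hiff]

end Quantile

/-! ### The law of a ratio of independent chi-squared variables -/

/-- Law of the ratio of independent chi-squared variables. -/
def ratioLaw (ν₁ ν₂ : ℝ) : Measure ℝ := (chiSquaredPair ν₁ ν₂).map fun u => u.1 / u.2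

lemma isProbabilityMeasure_ratioLaw {ν₁ ν₂ : ℝ} (h₁ : 0 < ν₁) (h₂ : 0 < ν₂) :
    IsProbabilityMeasure (ratioLaw ν₁ ν₂) := by
  have := isProbabilityMeasure_chiSquaredPair h₁ h₂
  exact Measure.isProbabilityMeasure_map (by fun_prop)

/-- The ratio equals `t` on a line whose section at each fixed denominator is a single point, null
for the numerator. -/
lemma nullSingletonClass_ratioLaw {ν₁ ν₂ : ℝ} (h₁ : 0 < ν₁) (h₂ : 0 < ν₂) :
    NullSingletonClass (ratioLaw ν₁ ν₂) where
  measure_singleton t := by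
    have := isProbabilityMeasure_chiSquared h₁
    have := isProbabilityMeasure_chiSquared h₂
    have hms : MeasurableSet {u : ℝ × ℝ | u.1 = t * u.2} :=
      measurableSet_eq_fun (by fun_prop) (by fun_prop)
    have h0 : chiSquaredPair ν₁ ν₂ {u : ℝ × ℝ | u.1 = t * u.2} = 0 := by
      rw [chiSquaredPair, Measure.prod_apply_symm hms]
      simp [preimage]
    rw [ratioLaw, Measure.map_apply (by fun_prop) (measurableSet_singleton t)]
    refine measure_mono_null_ae ?_ h0
    filter_upwards [ae_chiSquaredPair_pos h₁ h₂] with u hu hut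
    have hut : u.1 / u.2 = t := hut
    change u.1 = t * u.2
    rw [← hut, div_mul_cancel₀ _ hu.2.ne']

lemma lintegral_rpow_chiSquared {ν : ℝ} (hν : 0 < ν) (s : ℝ) :
    ∫⁻ u, ENNReal.ofReal (u ^ s) ∂chiSquared ν =
      ENNReal.ofReal ((1 / 2) ^ (ν / 2) / Real.Gamma (ν / 2)) *
        ∫⁻ u in Ioi 0, ENNReal.ofReal (u ^ (ν / 2 - 1 + s) * Real.exp (-(1 / 2) * u)) := by
  have := Real.Gamma_pos_of_pos (half_pos hν)
  rw [lintegral_chiSquared ν (by fun_prop), ← lintegral_const_mul _ (by fun_prop)]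
  refine setLIntegral_congr_fun measurableSet_Ioi fun u hu => ?_
  have hu : 0 < u := hu
  rw [gammaPDF_of_nonneg hu.le, ← ENNReal.ofReal_mul (by positivity),
    ← ENNReal.ofReal_mul (by positivity), Real.rpow_add hu]
  congr 1
  rw [neg_mul]
  ring

lemma lintegral_rpow_chiSquared_ne_top {ν s : ℝ} (hν : 0 < ν) (hs : -ν / 2 < s) :
    ∫⁻ u, ENNReal.ofReal (u ^ s) ∂chiSquared ν ≠ ⊤ := by
  rw [lintegral_rpow_chiSquared hν]
  have h := integrableOn_rpow_mul_exp_neg_mul_rpow (p := 1) (s := ν / 2 - 1 + s) (b := 1 / 2)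
    (by linarith) one_pos (by norm_num)
  simp only [Real.rpow_one] at h
  exact ENNReal.mul_ne_top ENNReal.ofReal_ne_top h.lintegral_lt_top.ne

/-- At this exponent the integrand behaves like `u⁻¹` near `0`. With the finiteness above this
exponent, it makes `-ν / 2` the threshold that determines `ν`. -/
lemma lintegral_rpow_chiSquared_eq_top {ν : ℝ} (hν : 0 < ν) :
    ∫⁻ u, ENNReal.ofReal (u ^ (-ν / 2)) ∂chiSquared ν = ⊤ := by
  have hG := Real.Gamma_pos_of_pos (half_pos hν)
  rw [lintegral_rpow_chiSquared hν]
  refine ENNReal.mul_eq_top.2 (Or.inl ⟨(ENNReal.ofReal_pos.2 (by positivity)).ne', ?_⟩)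
  by_contra htop
  have h1 : ∫⁻ u in Ioo (0 : ℝ) 1, ENNReal.ofReal (u ^ (-1 : ℝ)) ≤
      ENNReal.ofReal (Real.exp (1 / 2)) *
      ∫⁻ u in Ioi 0, ENNReal.ofReal (u ^ (ν / 2 - 1 + -ν / 2) * Real.exp (-(1 / 2) * u)) := by
    rw [← lintegral_const_mul _ (by fun_prop)]
    refine le_trans (setLIntegral_mono (by fun_prop) fun u hu => ?_)
      (lintegral_mono_set Ioo_subset_Ioi_self)
    rw [← ENNReal.ofReal_mul (Real.exp_pos _).le]
    refine ENNReal.ofReal_le_ofReal ?_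
    have hu0 : 0 < u ^ (-1 : ℝ) := Real.rpow_pos_of_pos hu.1 _
    rw [show ν / 2 - 1 + -ν / 2 = -1 by ring, mul_left_comm, ← Real.exp_add]
    refine le_mul_of_one_le_right hu0.le (Real.one_le_exp ?_)
    linarith [hu.2]
  have h2 : ∫⁻ u in Ioo (0 : ℝ) 1, ENNReal.ofReal (u ^ (-1 : ℝ)) ≠ ⊤ :=
    ne_top_of_le_ne_top (ENNReal.mul_ne_top ENNReal.ofReal_ne_top htop) h1
  rw [lintegral_ofReal_ne_top_iff_integrable (by fun_prop)
    ((ae_restrict_iff' measurableSet_Ioo).2 (ae_of_all _ fun u hu =>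
      (Real.rpow_pos_of_pos hu.1 _).le))] at h2
  have := (intervalIntegral.integrableOn_Ioo_rpow_iff one_pos).1 h2
  exact lt_irrefl _ this

lemma lintegral_rpow_chiSquared_ne_zero {ν : ℝ} (hν : 0 < ν) (s : ℝ) :
    ∫⁻ u, ENNReal.ofReal (u ^ s) ∂chiSquared ν ≠ 0 := by
  have := isProbabilityMeasure_chiSquared hν
  intro h
  rw [lintegral_eq_zero_iff (by fun_prop)] at h
  obtain ⟨u, hu, hu0⟩ := (h.and (chiSquared_ae_pos ν)).exists
  exact absurd hu (ENNReal.ofReal_pos.2 (Real.rpow_pos_of_pos hu0 s)).ne'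

lemma lintegral_rpow_ratioLaw {ν₁ ν₂ : ℝ} (h₁ : 0 < ν₁) (h₂ : 0 < ν₂) (s : ℝ) :
    ∫⁻ t, ENNReal.ofReal (t ^ s) ∂ratioLaw ν₁ ν₂ =
      (∫⁻ u, ENNReal.ofReal (u ^ s) ∂chiSquared ν₁) *
        ∫⁻ u, ENNReal.ofReal (u ^ (-s)) ∂chiSquared ν₂ := by
  have := isProbabilityMeasure_chiSquared h₁
  have := isProbabilityMeasure_chiSquared h₂
  rw [ratioLaw, lintegral_map (by fun_prop) (by fun_prop),
    ← lintegral_prod_mul (by fun_prop) (by fun_prop)]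
  refine lintegral_congr_ae ?_
  filter_upwards [ae_chiSquaredPair_pos h₁ h₂] with u hu
  rw [← ENNReal.ofReal_mul (Real.rpow_pos_of_pos hu.1 _).le, Real.div_rpow hu.1.le hu.2.le,
    Real.rpow_neg hu.2.le, div_eq_mul_inv]

/-- The degrees of freedom are determined by the range of the finite moments of the ratio. -/
lemma le_of_ratioLaw_eq {ν₁ ν₂ κ₁ κ₂ : ℝ} (hν₁ : 0 < ν₁) (hν₂ : 0 < ν₂) (hκ₁ : 0 < κ₁)
    (hκ₂ : 0 < κ₂) (h : ratioLaw ν₁ ν₂ = ratioLaw κ₁ κ₂) : κ₁ ≤ ν₁ ∧ κ₂ ≤ ν₂ := by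
  refine ⟨not_lt.1 fun hlt => ?_, not_lt.1 fun hlt => ?_⟩
  -- The critical exponent of the numerator: infinite for `ν₁`, finite if `ν₁ < κ₁`. The denominator
  -- then carries a positive power, which is always integrable.
  · have e := lintegral_rpow_ratioLaw hν₁ hν₂ (-ν₁ / 2)
    rw [lintegral_rpow_chiSquared_eq_top hν₁,
      ENNReal.top_mul (lintegral_rpow_chiSquared_ne_zero hν₂ _), h,
      lintegral_rpow_ratioLaw hκ₁ hκ₂] at e
    exact ENNReal.mul_ne_top (lintegral_rpow_chiSquared_ne_top hκ₁ (by linarith))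
      (lintegral_rpow_chiSquared_ne_top hκ₂ (by linarith)) e
  · have e := lintegral_rpow_ratioLaw hν₁ hν₂ (ν₂ / 2)
    rw [← neg_div, lintegral_rpow_chiSquared_eq_top hν₂,
      ENNReal.mul_top (lintegral_rpow_chiSquared_ne_zero hν₁ _), h,
      lintegral_rpow_ratioLaw hκ₁ hκ₂] at e
    exact ENNReal.mul_ne_top (lintegral_rpow_chiSquared_ne_top hκ₁ (by linarith))
      (lintegral_rpow_chiSquared_ne_top hκ₂ (by linarith)) e

lemma ratioLaw_inj {ν₁ ν₂ κ₁ κ₂ : ℝ} (hν₁ : 0 < ν₁) (hν₂ : 0 < ν₂) (hκ₁ : 0 < κ₁)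
    (hκ₂ : 0 < κ₂) (h : ratioLaw ν₁ ν₂ = ratioLaw κ₁ κ₂) : ν₁ = κ₁ ∧ ν₂ = κ₂ := by
  have h1 := le_of_ratioLaw_eq hν₁ hν₂ hκ₁ hκ₂ h
  have h2 := le_of_ratioLaw_eq hκ₁ hκ₂ hν₁ hν₂ h.symm
  exact ⟨le_antisymm h2.1 h1.1, le_antisymm h2.2 h1.2⟩

/-! ### The posterior law of `θ₄` and the coverage of the credible interval -/

section Posterior

variable {a b : ℝ} {n : ℕ} {X : Fin n → ℝ × ℝ}

/-- One identity gives both claims: the test function `1` shows that the total mass is the constant,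
which then cancels. -/
lemma posterior_map (ha : a < n) (hb : b < n) (hn : n ≠ 0) (hX : 0 < s11 X) (hr : 0 < rss X) :
    IsProbabilityMeasure (posterior a b X) ∧ (posterior a b X).map (fun p : Param =>
      (s11 X / p.2.2.1 ^ 2, rss X / (p.2.2.2.1 * √(1 - p.2.2.2.2 ^ 2)) ^ 2)) =
      chiSquaredPair (n - a) (n - b) := by
  have := isProbabilityMeasure_chiSquaredPair (sub_pos.2 ha) (sub_pos.2 hb)
  obtain ⟨C, hC0, hCt, hC⟩ := exists_lintegral_jointMeasure_eq ha hb hn hX hr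
  have huniv : jointMeasure a b X univ = C := by
    simpa using hC (fun _ => 1) measurable_const
  refine ⟨⟨?_⟩, Measure.ext_of_lintegral _ fun H hH => ?_⟩
  · rw [posterior, Measure.smul_apply, huniv, smul_eq_mul, ENNReal.inv_mul_cancel hC0 hCt]
  · rw [lintegral_map hH (by fun_prop), posterior, lintegral_smul_measure, huniv, hC H hH,
      smul_eq_mul, ← mul_assoc, ENNReal.inv_mul_cancel hC0 hCt, one_mul]

lemma ae_posterior_mem_paramSpace : ∀ᵐ p ∂posterior a b X, p ∈ paramSpace := by
  refine Measure.ae_smul_measure ?_ _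
  exact (withDensity_absolutelyContinuous _ _).ae_le (ae_restrict_mem measurableSet_paramSpace)

lemma posterior_map_theta4 (ha : a < n) (hb : b < n) (hn : n ≠ 0) (hX : 0 < s11 X)
    (hr : 0 < rss X) :
    (posterior a b X).map theta4 =
      (ratioLaw (n - a) (n - b)).map fun t => √t * √(rss X / s11 X) := by
  rw [ratioLaw, Measure.map_map (by fun_prop) (by fun_prop), ← (posterior_map ha hb hn hX hr).2,
    Measure.map_map (by fun_prop) (by fun_prop)]
  refine Measure.map_congr ?_
  filter_upwards [ae_posterior_mem_paramSpace] with p hp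
  obtain ⟨h₁, h₂, hρ⟩ := hp
  have hτ := mul_pos h₂ (Real.sqrt_pos.2 (one_sub_sq_pos hρ))
  simp only [Function.comp_apply, theta4]
  rw [← Real.sqrt_mul (by positivity)]
  symm
  rw [Real.sqrt_eq_iff_eq_sq (by positivity) (by positivity)]
  field_simp

lemma quantile_posterior_theta4 (ha : a < n) (hb : b < n) (hn : n ≠ 0) (hX : 0 < s11 X)
    (hr : 0 < rss X) {q : ℝ} (hq : q ∈ Ioo (0 : ℝ) 1) :
    quantile ((posterior a b X).map theta4) q =
      √(quantile (ratioLaw (n - a) (n - b)) q) * √(rss X / s11 X) := by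
  have := isProbabilityMeasure_ratioLaw (sub_pos.2 ha) (sub_pos.2 hb)
  rw [posterior_map_theta4 ha hb hn hX hr, quantile_map_sqrt_mul (by positivity) hq]

/-- Membership of `τ / σ` in the credible interval in terms of the ratio of sums
of squares. -/
lemma lt_sqrt_mul_sqrt_div_iff {σ τ s r t : ℝ} (hσ : 0 < σ) (hτ : 0 < τ) (hs : 0 < s)
    (hr : 0 < r) : τ / σ < √t * √(r / s) ↔ s / σ ^ 2 / (r / τ ^ 2) < t := by
  have hc : 0 < √(r / s) := by positivity
  rw [← div_lt_iff₀ hc, Real.lt_sqrt (by positivity), div_pow, Real.sq_sqrt (by positivity)]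
  rw [show (τ / σ) ^ 2 / (r / s) = s / σ ^ 2 / (r / τ ^ 2) by field_simp]

lemma posterior_credibleInterval (ha : a < n) (hb : b < n) (hn : n ≠ 0) (hX : 0 < s11 X)
    (hr : 0 < rss X) {α : ℝ} (hα : α ∈ Ioo (0 : ℝ) 1) :
    posterior a b X {p | theta4 p ∈ credibleInterval a b α X} = ENNReal.ofReal (1 - α) := by
  have hq : 1 - α ∈ Ioo (0 : ℝ) 1 := ⟨by linarith [hα.2], by linarith [hα.1]⟩
  have := isProbabilityMeasure_ratioLaw (sub_pos.2 ha) (sub_pos.2 hb)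
  have := nullSingletonClass_ratioLaw (sub_pos.2 ha) (sub_pos.2 hb)
  have hΦ : Measurable fun p : Param =>
      (s11 X / p.2.2.1 ^ 2, rss X / (p.2.2.2.1 * √(1 - p.2.2.2.2 ^ 2)) ^ 2) := by fun_prop
  rw [← measure_Iio_quantile (m := ratioLaw (n - a) (n - b)) hq]
  nth_rewrite 1 [ratioLaw]
  rw [Measure.map_apply (by fun_prop) measurableSet_Iio, ← (posterior_map ha hb hn hX hr).2,
    Measure.map_apply hΦ (measurableSet_Iio.preimage (by fun_prop))]
  refine measure_congr ?_
  filter_upwards [ae_posterior_mem_paramSpace] with p hp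
  obtain ⟨h₁, h₂, hρ⟩ := hp
  have hτ := mul_pos h₂ (Real.sqrt_pos.2 (one_sub_sq_pos hρ))
  refine propext ?_
  change theta4 p ∈ credibleInterval a b α X ↔ (_ : ℝ) < _
  rw [credibleInterval, quantile_posterior_theta4 ha hb hn hX hr hq, theta4, mem_Ioo,
    lt_sqrt_mul_sqrt_div_iff h₁ hτ hX hr]
  exact and_iff_right (div_pos hτ h₁)

/-- For almost every sample, the posterior quantile inequality is the inequality for the pivot `T`,
whose sampling law contains no parameters. -/
lemma coverage_eq (ha : a < n) (hb : b < n) (hn : 3 ≤ n) {p : Param} (hp : p ∈ paramSpace) {α : ℝ}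
    (hα : α ∈ Ioo (0 : ℝ) 1) :
    coverage a b α n p = ratioLaw (n - 1) (n - 2)
      (Iio (quantile (ratioLaw (n - a) (n - b)) (1 - α))) := by
  have hq : 1 - α ∈ Ioo (0 : ℝ) 1 := ⟨by linarith [hα.2], by linarith [hα.1]⟩
  obtain ⟨h₁, h₂, hρ⟩ := hp
  have hτ := mul_pos h₂ (Real.sqrt_pos.2 (one_sub_sq_pos hρ))
  have hm : Measurable fun X : Fin n → ℝ × ℝ =>
      (s11 X / p.2.2.1 ^ 2, rss X / (p.2.2.2.1 * √(1 - p.2.2.2.2 ^ 2)) ^ 2) :=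
    (measurable_s11.div_const _).prodMk (measurable_rss.div_const _)
  nth_rewrite 1 [ratioLaw]
  rw [coverage, Measure.map_apply (by fun_prop) measurableSet_Iio,
    ← sampleLaw_map hn p.1 p.2.1 h₁ h₂ hρ,
    Measure.map_apply hm (measurableSet_Iio.preimage (by fun_prop))]
  refine measure_congr ?_
  filter_upwards [ae_sampleLaw_pos hn p.1 p.2.1 h₁ h₂ hρ] with X hX
  refine propext ?_
  change theta4 p ∈ credibleInterval a b α X ↔ (_ : ℝ) < _
  rw [credibleInterval, quantile_posterior_theta4 ha hb (by omega) hX.1 hX.2 hq, theta4, mem_Ioo,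
    lt_sqrt_mul_sqrt_div_iff h₁ hτ hX.1 hX.2]
  -- The lower end of the interval costs nothing, as `θ₄` is positive.
  exact and_iff_right (div_pos hτ h₁)

end Posterior

end BivariateNormal

end

/-! ### The posterior law, the coverage and the exactly matching prior. -/

open BivariateNormal in
theorem theorem7 (n : ℕ) (hn : 3 ≤ n) (a b : ℝ) (ha : a < n) (hb : b < n) :
    -- the constructive posterior of `θ₄`
    (∀ X : Fin n → ℝ × ℝ, 0 < s11 X → 0 < s22 X → |corr X| < 1 →
      IsProbabilityMeasure (posterior a b X) ∧
      (posterior a b X).map theta4 =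
        (chiSquaredPair (n - a) (n - b)).map
          (fun u => √(u.1 / u.2) * √(s22 X * (1 - corr X ^ 2) / s11 X)) ∧
      ∀ α ∈ Ioo (0 : ℝ) 1,
        posterior a b X {p | theta4 p ∈ credibleInterval a b α X} = ENNReal.ofReal (1 - α)) ∧
    -- the frequentist coverage of the credible interval
    (∀ p ∈ paramSpace,
      (∀ α ∈ Ioo (0 : ℝ) 1,
        coverage a b α n p =
          chiSquaredPair (n - 1) (n - 2) {v | v.1 / v.2 <
            quantile ((chiSquaredPair (n - a) (n - b)).map fun u => u.1 / u.2) (1 - α)}) ∧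
      ((∀ α ∈ Ioo (0 : ℝ) 1, coverage a b α n p = ENNReal.ofReal (1 - α)) ↔ a = 1 ∧ b = 2)) := by
  have hn0 : n ≠ 0 := by omega
  have hn3 : (3 : ℝ) ≤ n := by exact_mod_cast hn
  have h1 : (0 : ℝ) < n - 1 := by linarith
  have h2 : (0 : ℝ) < n - 2 := by linarith
  have := isProbabilityMeasure_ratioLaw h1 h2
  have := nullSingletonClass_ratioLaw h1 h2
  have := isProbabilityMeasure_ratioLaw (sub_pos.2 ha) (sub_pos.2 hb)
  refine ⟨fun X h11 h22 hr => ?_, fun p hp => ⟨fun α hα => ?_, fun h => ?_, ?_⟩⟩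
  · have hrss := rss_pos h11 h22 hr
    refine ⟨(posterior_map ha hb hn0 h11 hrss).1, ?_,
      fun α hα => posterior_credibleInterval ha hb hn0 h11 hrss hα⟩
    rw [posterior_map_theta4 ha hb hn0 h11 hrss, s22_mul_one_sub_corr_sq h11 h22, ratioLaw,
      Measure.map_map (by fun_prop) (by fun_prop)]
    rfl
  · rw [coverage_eq ha hb hn hp hα]
    nth_rewrite 1 [ratioLaw]
    rw [Measure.map_apply (by fun_prop) measurableSet_Iio]
    rfl
  · have heq : ratioLaw (n - 1) (n - 2) = ratioLaw (n - a) (n - b) := by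
      refine eq_of_measure_Iio_quantile fun q hq => ?_
      -- Every quantile level `q` arises from the credible level `α = 1 - q`.
      have hα : 1 - q ∈ Ioo (0 : ℝ) 1 := ⟨by linarith [hq.2], by linarith [hq.1]⟩
      have := h (1 - q) hα
      rwa [coverage_eq ha hb hn hp hα, sub_sub_cancel] at this
    have := ratioLaw_inj h1 h2 (sub_pos.2 ha) (sub_pos.2 hb) heq
    exact ⟨by linarith [this.1], by linarith [this.2]⟩
  · rintro ⟨rfl, rfl⟩ α hα
    -- With these values the posterior and sampling ratio laws coincide, so a law without atoms is
    -- evaluated below its own quantile.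
    rw [coverage_eq ha hb hn hp hα, measure_Iio_quantile]
    exact ⟨by linarith [hα.2], by linarith [hα.1]⟩
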